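/- Let $\mathbb{D}$ be the open unit disk in $\mathbb{C}$, let $0<\alpha<\infty$ and $0<\beta<\infty$, let $u$ be analytic on $\mathbb{D}$ and let $\varphi$ be an analytic self-map of $\mathbb{D}$. Let $\mathcal{B}^\alpha$ be the space of analytic functions $f$ on $\mathbb{D}$ with finite norm $|f(0)|+\sup_{z\in\mathbb{D}}(1-|z|^2)^\alpha|f'(z)|$, and let $\mathcal{Z}_\beta$ be the space of analytic functions $f$ on $\mathbb{D}$ with finite norm $|f(0)|+|f'(0)|+\sup_{z\in\mathbb{D}}(1-|z|^2)^\beta|f''(z)|$. Write $(uC_\varphi f)(z)=u(z)f(\varphi(z))$, $\|g\|_{\nu_\beta}=\sup_{z\in\mathbb{D}}(1-|z|^2)^\beta|g(z)|\in[0,\infty]$, and $\varphi^n$ for the $n$-th power $z\mapsto\varphi(z)^n$. Then the following are equivalent. (a) $uC_\varphi:\mathcal{B}^\alpha\to\mathcal{Z}_\beta$ is compact. (b) $uC_\varphi:\mathcal{B}^\alpha\to\mathcal{Z}_\beta$ is bounded, $$\limsup_{n\to\infty}(n+1)^\alpha\|(2u'\varphi'+u\varphi'')\varphi^n\|_{\nu_\beta}=0,\qquad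 \limsup_{n\to\infty}(n+1)^{\alpha+1}\|u(\varphi')^2\varphi^n\|_{\nu_\beta}=0,$$ and moreover, if $\alpha=1$, then $\limsup_{n\to\infty}(\log n)\|u''\varphi^n\|_{\nu_\beta}=0$, and, if $\alpha>1$, then $\limsup_{n\to\infty}(n+1)^{\alpha-1}\|u''\varphi^n\|_{\nu_\beta}=0$. (In (a) and (b), "compact" and "bounded" include that $uC_\varphi$ maps $\mathcal{B}^\alpha$ into $\mathcal{Z}_\beta$.) -/

import Mathlib

open Filter
open scoped ENNReal

noncomputable section

namespace BlochZygmund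

/-- The open unit disk. -/
abbrev disk : Set ℂ := Metric.ball 0 1

/-- The weighted supremum `‖f‖_{ν_γ} = sup_{z ∈ 𝔻} (1 - |z|²)^γ |f z|`, with values in `[0, ∞]`. -/
def weightedSup (γ : ℝ) (f : ℂ → ℂ) : ℝ≥0∞ :=
  ⨆ z : disk, ENNReal.ofReal ((1 - ‖(z : ℂ)‖ ^ 2) ^ γ * ‖f z‖)

theorem weight_pos (γ : ℝ) (z : disk) : 0 < (1 - ‖(z : ℂ)‖ ^ 2) ^ γ := by
  have h : ‖(z : ℂ)‖ < 1 := mem_ball_zero_iff.1 z.2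
  apply Real.rpow_pos_of_pos
  nlinarith [norm_nonneg (z : ℂ)]

theorem weightedSup_congr {γ : ℝ} {f g : ℂ → ℂ} (h : Set.EqOn f g disk) :
    weightedSup γ f = weightedSup γ g :=
  iSup_congr fun z => by rw [h z.2]

theorem weightedSup_zero (γ : ℝ) : weightedSup γ (fun _ => 0) = 0 := by
  simp [weightedSup]

theorem weightedSup_add_le (γ : ℝ) (f g : ℂ → ℂ) :
    weightedSup γ (fun z => f z + g z) ≤ weightedSup γ f + weightedSup γ g := by
  refine iSup_le fun z => ?_
  have hw := (weight_pos γ z).le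
  calc ENNReal.ofReal ((1 - ‖(z : ℂ)‖ ^ 2) ^ γ * ‖f z + g z‖)
      ≤ ENNReal.ofReal ((1 - ‖(z : ℂ)‖ ^ 2) ^ γ * ‖f z‖ + (1 - ‖(z : ℂ)‖ ^ 2) ^ γ * ‖g z‖) := by
        apply ENNReal.ofReal_le_ofReal
        rw [← mul_add]
        exact mul_le_mul_of_nonneg_left (norm_add_le _ _) hw
    _ = ENNReal.ofReal ((1 - ‖(z : ℂ)‖ ^ 2) ^ γ * ‖f z‖)
          + ENNReal.ofReal ((1 - ‖(z : ℂ)‖ ^ 2) ^ γ * ‖g z‖) :=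
        ENNReal.ofReal_add (by positivity) (by positivity)
    _ ≤ _ := add_le_add
        (le_iSup (fun z : disk => ENNReal.ofReal ((1 - ‖(z : ℂ)‖ ^ 2) ^ γ * ‖f z‖)) z)
        (le_iSup (fun z : disk => ENNReal.ofReal ((1 - ‖(z : ℂ)‖ ^ 2) ^ γ * ‖g z‖)) z)

theorem weightedSup_smul (γ : ℝ) (c : ℂ) (f : ℂ → ℂ) :
    weightedSup γ (fun z => c * f z) = ENNReal.ofReal ‖c‖ * weightedSup γ f := by
  unfold weightedSup
  rw [ENNReal.mul_iSup]
  refine iSup_congr fun z => ?_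
  rw [← ENNReal.ofReal_mul (norm_nonneg c), norm_mul]
  congr 1
  ring

theorem eqOn_zero_of_weightedSup {γ : ℝ} {f : ℂ → ℂ} (h : weightedSup γ f = 0) :
    ∀ z ∈ disk, f z = 0 := by
  intro z hz
  have h1 := ENNReal.iSup_eq_zero.1 h ⟨z, hz⟩
  have h2 := ENNReal.ofReal_eq_zero.1 h1
  have h3 := weight_pos γ ⟨z, hz⟩
  have h4 : ‖f z‖ ≤ 0 := by
    by_contra hc
    exact absurd h2 (not_le.2 (mul_pos h3 (not_le.1 hc)))
  simpa using h4

/-- `H(𝔻)`: the functions analytic on the unit disk. Such a function is represented by its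
extension by zero to the whole plane, so that equality in this type is equality on the disk. -/
def holo : Submodule ℂ (ℂ → ℂ) where
  carrier := {f | DifferentiableOn ℂ f disk ∧ ∀ z ∉ disk, f z = 0}
  add_mem' := fun hf hg => ⟨hf.1.add hg.1, fun z hz => by simp [hf.2 z hz, hg.2 z hz]⟩
  zero_mem' := ⟨differentiableOn_const 0, fun _ _ => rfl⟩
  smul_mem' := fun c _ hf => ⟨hf.1.const_smul c, fun z hz => by simp [hf.2 z hz]⟩

theorem holo_diff {f : ℂ → ℂ} (hf : f ∈ holo) {z : ℂ} (hz : z ∈ disk) :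
    DifferentiableAt ℂ f z :=
  hf.1.differentiableAt (Metric.isOpen_ball.mem_nhds hz)

theorem holo_diff_deriv {f : ℂ → ℂ} (hf : f ∈ holo) {z : ℂ} (hz : z ∈ disk) :
    DifferentiableAt ℂ (deriv f) z :=
  (hf.1.deriv Metric.isOpen_ball).differentiableAt (Metric.isOpen_ball.mem_nhds hz)

theorem deriv_add_on {f g : ℂ → ℂ} (hf : f ∈ holo) (hg : g ∈ holo) :
    Set.EqOn (deriv (f + g)) (fun z => deriv f z + deriv g z) disk :=
  fun _ hz => deriv_add (holo_diff hf hz) (holo_diff hg hz)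

theorem deriv_smul_on {f : ℂ → ℂ} (c : ℂ) (hf : f ∈ holo) :
    Set.EqOn (deriv (c • f)) (fun z => c * deriv f z) disk :=
  fun _ hz => deriv_const_smul c (holo_diff hf hz)

theorem deriv2_add_on {f g : ℂ → ℂ} (hf : f ∈ holo) (hg : g ∈ holo) :
    Set.EqOn (deriv (deriv (f + g))) (fun z => deriv (deriv f) z + deriv (deriv g) z) disk := by
  intro z hz
  rw [((deriv_add_on hf hg).eventuallyEq_of_mem (Metric.isOpen_ball.mem_nhds hz)).deriv_eq]
  exact deriv_add (holo_diff_deriv hf hz) (holo_diff_deriv hg hz)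

theorem deriv2_smul_on {f : ℂ → ℂ} (c : ℂ) (hf : f ∈ holo) :
    Set.EqOn (deriv (deriv (c • f))) (fun z => c * deriv (deriv f) z) disk := by
  intro z hz
  rw [((deriv_smul_on c hf).eventuallyEq_of_mem (Metric.isOpen_ball.mem_nhds hz)).deriv_eq]
  exact deriv_const_mul c (holo_diff_deriv hf hz)

theorem eqOn_zero_of_deriv {f : ℂ → ℂ} (hd : DifferentiableOn ℂ f disk)
    (h : ∀ z ∈ disk, deriv f z = 0) (h0 : f 0 = 0) : ∀ z ∈ disk, f z = 0 := by
  intro z hz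
  have := Metric.isOpen_ball.is_const_of_deriv_eq_zero
    (convex_ball (0 : ℂ) 1).isPreconnected hd h hz (Metric.mem_ball_self one_pos)
  rw [this, h0]

theorem zero_mem_disk : (0 : ℂ) ∈ disk := Metric.mem_ball_self one_pos

/-- The Bloch type space `𝓑^α`, as a linear subspace of the functions on the plane. -/
def blochSubmodule (α : ℝ) : Submodule ℂ (ℂ → ℂ) where
  carrier := {f | f ∈ holo ∧ weightedSup α (deriv f) < ∞}
  add_mem' := by
    rintro f g ⟨hf, hf'⟩ ⟨hg, hg'⟩
    refine ⟨holo.add_mem hf hg, ?_⟩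
    rw [weightedSup_congr (deriv_add_on hf hg)]
    exact (weightedSup_add_le _ _ _).trans_lt (ENNReal.add_lt_top.2 ⟨hf', hg'⟩)
  zero_mem' := ⟨holo.zero_mem, by simp [weightedSup, Pi.zero_def]⟩
  smul_mem' := by
    rintro c f ⟨hf, hf'⟩
    refine ⟨holo.smul_mem c hf, ?_⟩
    rw [weightedSup_congr (deriv_smul_on c hf), weightedSup_smul]
    exact ENNReal.mul_lt_top ENNReal.ofReal_lt_top hf'

/-- The Zygmund type space `𝓩_β`, as a linear subspace of the functions on the plane. -/
def zygmundSubmodule (β : ℝ) : Submodule ℂ (ℂ → ℂ) where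
  carrier := {f | f ∈ holo ∧ weightedSup β (deriv (deriv f)) < ∞}
  add_mem' := by
    rintro f g ⟨hf, hf'⟩ ⟨hg, hg'⟩
    refine ⟨holo.add_mem hf hg, ?_⟩
    rw [weightedSup_congr (deriv2_add_on hf hg)]
    exact (weightedSup_add_le _ _ _).trans_lt (ENNReal.add_lt_top.2 ⟨hf', hg'⟩)
  zero_mem' := ⟨holo.zero_mem, by simp [weightedSup, Pi.zero_def]⟩
  smul_mem' := by
    rintro c f ⟨hf, hf'⟩
    refine ⟨holo.smul_mem c hf, ?_⟩
    rw [weightedSup_congr (deriv2_smul_on c hf), weightedSup_smul]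
    exact ENNReal.mul_lt_top ENNReal.ofReal_lt_top hf'

/-- The Bloch type space `𝓑^α` as a type of its own, so that its only topology is the one of the
norm below (and not the topology of pointwise convergence). -/
def Bloch (α : ℝ) : Type := blochSubmodule α

/-- The Zygmund type space `𝓩_β` as a type of its own, with the topology of the norm below. -/
def Zygmund (β : ℝ) : Type := zygmundSubmodule β

instance (α : ℝ) : AddCommGroup (Bloch α) := inferInstanceAs (AddCommGroup (blochSubmodule α))

instance (α : ℝ) : Module ℂ (Bloch α) := inferInstanceAs (Module ℂ (blochSubmodule α))

instance (β : ℝ) : AddCommGroup (Zygmund β) :=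
  inferInstanceAs (AddCommGroup (zygmundSubmodule β))

instance (β : ℝ) : Module ℂ (Zygmund β) := inferInstanceAs (Module ℂ (zygmundSubmodule β))

/-- The function that an element of `𝓑^α` is. -/
def Bloch.toFun {α : ℝ} (f : Bloch α) : ℂ → ℂ := f.1

/-- The function that an element of `𝓩_β` is. -/
def Zygmund.toFun {β : ℝ} (f : Zygmund β) : ℂ → ℂ := f.1

theorem Bloch.toFun_smul {α : ℝ} (c : ℂ) (f : Bloch α) : (c • f).toFun = c • f.toFun := rfl

theorem Bloch.toFun_add {α : ℝ} (f g : Bloch α) : (f + g).toFun = f.toFun + g.toFun := rfl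

theorem Bloch.toFun_zero {α : ℝ} : (0 : Bloch α).toFun = 0 := rfl

theorem Bloch.mem {α : ℝ} (f : Bloch α) :
    f.toFun ∈ holo ∧ weightedSup α (deriv f.toFun) < ∞ := f.2

theorem Zygmund.toFun_smul {β : ℝ} (c : ℂ) (f : Zygmund β) : (c • f).toFun = c • f.toFun := rfl

theorem Zygmund.toFun_add {β : ℝ} (f g : Zygmund β) : (f + g).toFun = f.toFun + g.toFun := rfl

theorem Zygmund.toFun_zero {β : ℝ} : (0 : Zygmund β).toFun = 0 := rfl

theorem Zygmund.mem {β : ℝ} (f : Zygmund β) :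
    f.toFun ∈ holo ∧ weightedSup β (deriv (deriv f.toFun)) < ∞ := f.2

/-- `‖f‖ = |f(0)| + sup_{z ∈ 𝔻} (1 - |z|²)^α |f'(z)|`. -/
instance (α : ℝ) : Norm (Bloch α) where
  norm f := ‖f.toFun 0‖ + (weightedSup α (deriv f.toFun)).toReal

/-- `‖f‖ = |f(0)| + |f'(0)| + sup_{z ∈ 𝔻} (1 - |z|²)^β |f''(z)|`. -/
instance (β : ℝ) : Norm (Zygmund β) where
  norm f := ‖f.toFun 0‖ + ‖deriv f.toFun 0‖
    + (weightedSup β (deriv (deriv f.toFun))).toReal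

theorem Bloch.norm_def {α : ℝ} (f : Bloch α) :
    ‖f‖ = ‖f.toFun 0‖ + (weightedSup α (deriv f.toFun)).toReal := rfl

theorem Zygmund.norm_def {β : ℝ} (f : Zygmund β) :
    ‖f‖ = ‖f.toFun 0‖ + ‖deriv f.toFun 0‖
      + (weightedSup β (deriv (deriv f.toFun))).toReal := rfl

theorem Bloch.core (α : ℝ) : NormedSpace.Core ℂ (Bloch α) where
  norm_nonneg f := by rw [Bloch.norm_def]; positivity
  norm_smul c f := by
    simp only [Bloch.norm_def, Bloch.toFun_smul]
    rw [weightedSup_congr (deriv_smul_on c f.mem.1), weightedSup_smul, ENNReal.toReal_mul,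
      ENNReal.toReal_ofReal (norm_nonneg c)]
    simp [mul_add]
  norm_triangle f g := by
    simp only [Bloch.norm_def, Bloch.toFun_add]
    rw [weightedSup_congr (deriv_add_on f.mem.1 g.mem.1)]
    have h1 := ENNReal.toReal_mono (ENNReal.add_lt_top.2 ⟨f.mem.2, g.mem.2⟩).ne
      (weightedSup_add_le α (deriv f.toFun) (deriv g.toFun))
    rw [ENNReal.toReal_add f.mem.2.ne g.mem.2.ne] at h1
    have h2 := norm_add_le (f.toFun 0) (g.toFun 0)
    simp only [Pi.add_apply]
    linarith
  norm_eq_zero_iff f := by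
    constructor
    · intro h
      rw [Bloch.norm_def] at h
      have ha := norm_nonneg (f.toFun 0)
      have hb : 0 ≤ (weightedSup α (deriv f.toFun)).toReal := ENNReal.toReal_nonneg
      have h0 : f.toFun 0 = 0 := norm_eq_zero.1 (by linarith)
      have h1 : weightedSup α (deriv f.toFun) = 0 :=
        ((ENNReal.toReal_eq_zero_iff _).1 (by linarith)).resolve_right f.mem.2.ne
      have h2 := eqOn_zero_of_deriv f.mem.1.1 (eqOn_zero_of_weightedSup h1) h0
      refine Subtype.ext (funext fun z => ?_)
      by_cases hz : z ∈ disk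
      · exact h2 z hz
      · exact f.mem.1.2 z hz
    · rintro rfl
      simp [Bloch.norm_def, Bloch.toFun_zero, weightedSup, Pi.zero_def]

theorem Zygmund.core (β : ℝ) : NormedSpace.Core ℂ (Zygmund β) where
  norm_nonneg f := by rw [Zygmund.norm_def]; positivity
  norm_smul c f := by
    simp only [Zygmund.norm_def, Zygmund.toFun_smul]
    rw [weightedSup_congr (deriv2_smul_on c f.mem.1), weightedSup_smul, ENNReal.toReal_mul,
      ENNReal.toReal_ofReal (norm_nonneg c), deriv_smul_on c f.mem.1 zero_mem_disk]
    simp [mul_add]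
  norm_triangle f g := by
    simp only [Zygmund.norm_def, Zygmund.toFun_add]
    rw [weightedSup_congr (deriv2_add_on f.mem.1 g.mem.1), deriv_add_on f.mem.1 g.mem.1 zero_mem_disk]
    have h1 := ENNReal.toReal_mono (ENNReal.add_lt_top.2 ⟨f.mem.2, g.mem.2⟩).ne
      (weightedSup_add_le β (deriv (deriv f.toFun)) (deriv (deriv g.toFun)))
    rw [ENNReal.toReal_add f.mem.2.ne g.mem.2.ne] at h1
    have h2 := norm_add_le (f.toFun 0) (g.toFun 0)
    have h3 := norm_add_le (deriv f.toFun 0) (deriv g.toFun 0)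
    simp only [Pi.add_apply]
    linarith
  norm_eq_zero_iff f := by
    constructor
    · intro h
      rw [Zygmund.norm_def] at h
      have ha := norm_nonneg (f.toFun 0)
      have hc := norm_nonneg (deriv f.toFun 0)
      have hb : 0 ≤ (weightedSup β (deriv (deriv f.toFun))).toReal := ENNReal.toReal_nonneg
      have h0 : f.toFun 0 = 0 := norm_eq_zero.1 (by linarith)
      have h0' : deriv f.toFun 0 = 0 := norm_eq_zero.1 (by linarith)
      have h1 : weightedSup β (deriv (deriv f.toFun)) = 0 :=
        ((ENNReal.toReal_eq_zero_iff _).1 (by linarith)).resolve_right f.mem.2.ne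
      have h2 := eqOn_zero_of_deriv (f.mem.1.1.deriv Metric.isOpen_ball)
        (eqOn_zero_of_weightedSup h1) h0'
      have h3 := eqOn_zero_of_deriv f.mem.1.1 h2 h0
      refine Subtype.ext (funext fun z => ?_)
      by_cases hz : z ∈ disk
      · exact h3 z hz
      · exact f.mem.1.2 z hz
    · rintro rfl
      simp [Zygmund.norm_def, Zygmund.toFun_zero, weightedSup, Pi.zero_def]

instance (α : ℝ) : NormedAddCommGroup (Bloch α) := NormedAddCommGroup.ofCore (Bloch.core α)

instance (α : ℝ) : NormedSpace ℂ (Bloch α) := NormedSpace.ofCore (Bloch.core α)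

instance (β : ℝ) : NormedAddCommGroup (Zygmund β) := NormedAddCommGroup.ofCore (Zygmund.core β)

instance (β : ℝ) : NormedSpace ℂ (Zygmund β) := NormedSpace.ofCore (Zygmund.core β)

/-- The linear map `T : 𝓑^α → 𝓩_β` is the weighted composition operator
`uC_φ f (z) = u(z) f(φ(z))`, `z ∈ 𝔻`. Such a `T` is unique, and it exists exactly when `uC_φ`
maps `𝓑^α` into `𝓩_β`. -/
def IsWeightedComp {α β : ℝ} (u φ : ℂ → ℂ) (T : Bloch α →ₗ[ℂ] Zygmund β) : Prop :=
  ∀ f : Bloch α, ∀ z ∈ disk, (T f).toFun z = u z * f.toFun (φ z)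

/-- `uC_φ : 𝓑^α → 𝓩_β` is a bounded operator. -/
def BoundedWeightedComp (α β : ℝ) (u φ : ℂ → ℂ) : Prop :=
  ∃ T : Bloch α →ₗ[ℂ] Zygmund β, IsWeightedComp u φ T ∧ ∃ C : ℝ, ∀ f, ‖T f‖ ≤ C * ‖f‖

/-- `uC_φ : 𝓑^α → 𝓩_β` is a compact operator. -/
def CompactWeightedComp (α β : ℝ) (u φ : ℂ → ℂ) : Prop :=
  ∃ T : Bloch α →ₗ[ℂ] Zygmund β, IsWeightedComp u φ T ∧ IsCompactOperator T

end BlochZygmund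

end

/-!
The second derivative of `u · f ∘ φ` is `u'' f(φ) + (2u'φ' + uφ'') f'(φ) + u(φ')² f''(φ)`.
Functions in `𝓑^α` satisfy `|f'(w)| ≲ (1 - |w|²)^(-α)` and `|f''(w)| ≲ (1 - |w|²)^(-α-1)`, while
`f` itself is `O((1 - |w|²)^(1-α))` for `α > 1`, logarithmic for `α = 1`, and continuous up to the
boundary for `α < 1`. Compactness is therefore equivalent to little-oh conditions on the three
coefficients as `|φ(z)| → 1`. They suffice because, by Montel's theorem, it is enough to test the
operator on bounded families that tend to zero locally uniformly. They are necessary because the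
operator sends to zero the kernels `(1 - |a|²)^(p+1-α) (1 - āw)^(-p)`, `a = φ(z)`: the three terms
depend on `p` as `1`, `p` and `p(p + 1)`, so finite differences in `p` separate them. For `α = 1`
a logarithmic kernel gives the stronger condition on `u''`.

The conditions on `φⁿ` say the same: `(1 - x²)^(-γ)` and `1 - log (1 - x²)` are comparable to
`sup_n (n + 1)^γ xⁿ` and `1 + sup_n (log n) xⁿ`, the supremum being attained
near `n = 1 / (1 - x)`.
-/

open scoped Topology ComplexConjugate

noncomputable section

namespace BlochZygmund

/-! ### Weighted suprema and boundary conditions -/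

theorem mul_div_add_one_le {S ε : ℝ} (hS : 0 ≤ S) (hε : 0 ≤ ε) : S * (ε / (S + 1)) ≤ ε := by
  rw [mul_div_left_comm]
  exact mul_le_of_le_one_right hε ((div_le_one (by positivity)).2 (by linarith))

section WeightedSup

variable {γ : ℝ} {f g : ℂ → ℂ}

theorem norm_lt_one {z : ℂ} (hz : z ∈ disk) : ‖z‖ < 1 := mem_ball_zero_iff.1 hz

theorem mem_disk {z : ℂ} (hz : ‖z‖ < 1) : z ∈ disk := mem_ball_zero_iff.2 hz

theorem one_sub_norm_sq_pos {z : ℂ} (hz : z ∈ disk) : 0 < 1 - ‖z‖ ^ 2 := by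
  nlinarith [norm_lt_one hz, norm_nonneg z]

theorem ofReal_le_weightedSup {z : ℂ} (hz : z ∈ disk) :
    ENNReal.ofReal ((1 - ‖z‖ ^ 2) ^ γ * ‖f z‖) ≤ weightedSup γ f :=
  le_iSup (fun z : disk => ENNReal.ofReal ((1 - ‖(z : ℂ)‖ ^ 2) ^ γ * ‖f z‖)) ⟨z, hz⟩

theorem le_toReal_weightedSup (h : weightedSup γ f < ∞) {z : ℂ} (hz : z ∈ disk) :
    (1 - ‖z‖ ^ 2) ^ γ * ‖f z‖ ≤ (weightedSup γ f).toReal :=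
  (ENNReal.ofReal_le_iff_le_toReal h.ne).1 (ofReal_le_weightedSup hz)

theorem weightedSup_le_ofReal {C : ℝ} (h : ∀ z ∈ disk, (1 - ‖z‖ ^ 2) ^ γ * ‖f z‖ ≤ C) :
    weightedSup γ f ≤ ENNReal.ofReal C :=
  iSup_le fun z => ENNReal.ofReal_le_ofReal (h z z.2)

theorem weightedSup_mono (h : ∀ z ∈ disk, ‖f z‖ ≤ ‖g z‖) : weightedSup γ f ≤ weightedSup γ g :=
  iSup_mono fun z => ENNReal.ofReal_le_ofReal <|
    mul_le_mul_of_nonneg_left (h z z.2) (weight_pos γ z).le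

theorem tendsto_weightedSup_zero {ι : Type*} {l : Filter ι} {F : ι → ℂ → ℂ}
    (h : ∀ ε > 0, ∀ᶠ i in l, ∀ z ∈ disk, (1 - ‖z‖ ^ 2) ^ γ * ‖F i z‖ ≤ ε) :
    Tendsto (fun i => weightedSup γ (F i)) l (𝓝 0) := by
  refine tendsto_order.2 ⟨fun _ h => absurd h not_lt_zero, fun ε hε => ?_⟩
  obtain ⟨δ, hδ, hδε⟩ := ENNReal.lt_iff_exists_nnreal_btwn.1 hε
  filter_upwards [h δ (by exact_mod_cast hδ)] with i hi
  exact (weightedSup_le_ofReal hi).trans_lt (by simpa using hδε)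

theorem tendsto_weightedSup_mul_of_tendstoUniformlyOn {ι : Type*} {l : Filter ι} {H : ι → ℂ → ℂ}
    (hg : weightedSup γ g < ∞) (hH : TendstoUniformlyOn H 0 l disk) :
    Tendsto (fun i => weightedSup γ fun z => g z * H i z) l (𝓝 0) := by
  refine tendsto_weightedSup_zero fun ε hε => ?_
  set S := (weightedSup γ g).toReal
  have hS : 0 ≤ S := ENNReal.toReal_nonneg
  filter_upwards [Metric.tendstoUniformlyOn_iff.1 hH (ε / (S + 1)) (by positivity)] with i hi z hz
  have hHz : ‖H i z‖ ≤ ε / (S + 1) := by simpa using (hi z hz).le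
  calc (1 - ‖z‖ ^ 2) ^ γ * ‖g z * H i z‖ = (1 - ‖z‖ ^ 2) ^ γ * ‖g z‖ * ‖H i z‖ := by
        rw [norm_mul, mul_assoc]
    _ ≤ S * (ε / (S + 1)) := by gcongr; exact le_toReal_weightedSup hg hz
    _ ≤ ε := mul_div_add_one_le hS hε.le

end WeightedSup

/-- The filter on the disk of the neighbourhoods of the boundary as seen through `φ`: convergence
along it is convergence as `|φ(z)| → 1`. -/
def towardBoundary (φ : ℂ → ℂ) : Filter disk :=
  comap (fun z : disk => ‖φ z‖) (𝓝[<] 1)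

/-- The little-oh condition `(1 - |z|²)^β |G(z)| Φ(|φ(z)|) → 0` as `|φ(z)| → 1`. -/
def VanishesTowardBoundary (β : ℝ) (φ G : ℂ → ℂ) (Φ : ℝ → ℝ) : Prop :=
  Tendsto (fun z : disk => (1 - ‖(z : ℂ)‖ ^ 2) ^ β * ‖G z‖ * Φ ‖φ z‖) (towardBoundary φ) (𝓝 0)

/-- The growth rate `c` of a sequence and the blow-up rate `Φ` of a radial function at `1` match
when `Φ(x)` is comparable to `sup_n c(n) xⁿ`, the supremum being essentially attained at
`n ≈ 1 / (1 - x)`. -/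
structure MatchingScale (c : ℕ → ℝ) (Φ : ℝ → ℝ) : Prop where
  coeff_nonneg : ∀ n, 0 ≤ c n
  scale_nonneg : ∀ x ∈ Set.Ico (0 : ℝ) 1, 0 ≤ Φ x
  coeff_mul_pow_le : ∃ K ≥ 0, ∀ n, ∀ x ∈ Set.Ico (0 : ℝ) 1, c n * x ^ n ≤ K * Φ x
  scale_le : ∃ K ≥ 0, ∀ᶠ n : ℕ in atTop, ∀ x ∈ Set.Ico (0 : ℝ) 1,
    (1 - x)⁻¹ ≤ 2 * ((n : ℝ) + 1) → Φ x ≤ K * c n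

section Scales

variable {β : ℝ} {φ G : ℂ → ℂ} {c : ℕ → ℝ} {Φ : ℝ → ℝ}

theorem hasBasis_towardBoundary (φ : ℂ → ℂ) :
    (towardBoundary φ).HasBasis (· < 1) fun r => {z : disk | ‖φ z‖ ∈ Set.Ioo r 1} :=
  (nhdsLT_basis (1 : ℝ)).comap _

theorem tendsto_norm_towardBoundary (φ : ℂ → ℂ) :
    Tendsto (fun z : disk => ‖φ z‖) (towardBoundary φ) (𝓝[<] 1) :=
  tendsto_comap

theorem MatchingScale.tendsto_mul_pow (h : MatchingScale c Φ) {r : ℝ} (hr : r ∈ Set.Ico (0 : ℝ) 1) :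
    Tendsto (fun n => c n * r ^ n) atTop (𝓝 0) := by
  obtain ⟨K, -, hK⟩ := h.coeff_mul_pow_le
  have hs : √r ∈ Set.Ico (0 : ℝ) 1 := ⟨Real.sqrt_nonneg r, by
    simpa using Real.sqrt_lt_sqrt hr.1 hr.2⟩
  refine squeeze_zero (g := fun n => K * Φ √r * √r ^ n)
    (fun n => mul_nonneg (h.coeff_nonneg n) (pow_nonneg hr.1 n)) (fun n => ?_)
    (by simpa using (tendsto_pow_atTop_nhds_zero_of_lt_one hs.1 hs.2).const_mul (K * Φ √r))
  calc c n * r ^ n = c n * √r ^ n * √r ^ n := by rw [mul_assoc, ← mul_pow, Real.mul_self_sqrt hr.1]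
    _ ≤ K * Φ √r * √r ^ n := mul_le_mul_of_nonneg_right (hK n _ hs) (pow_nonneg hs.1 n)

theorem half_le_pow_floor {x : ℝ} (hx : x ∈ Set.Ico (0 : ℝ) 1) :
    1 / 2 ≤ x ^ ⌊(2 * (1 - x))⁻¹⌋₊ := by
  have hx' : 0 < 1 - x := sub_pos.2 hx.2
  have hfloor : (⌊(2 * (1 - x))⁻¹⌋₊ : ℝ) * (1 - x) ≤ 1 / 2 := by
    calc (⌊(2 * (1 - x))⁻¹⌋₊ : ℝ) * (1 - x) ≤ (2 * (1 - x))⁻¹ * (1 - x) := by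
          gcongr
          exact Nat.floor_le (by positivity)
      _ = 1 / 2 := by field_simp
  have bernoulli := one_add_mul_le_pow (a := x - 1) (by linarith [hx.1]) ⌊(2 * (1 - x))⁻¹⌋₊
  rw [add_sub_cancel] at bernoulli
  linarith

theorem tendsto_floor_inv_one_sub :
    Tendsto (fun x : ℝ => ⌊(2 * (1 - x))⁻¹⌋₊) (𝓝[<] 1) atTop := by
  refine tendsto_nat_floor_atTop.comp (tendsto_inv_nhdsGT_zero.comp ?_)
  refine tendsto_nhdsWithin_iff.2 ⟨tendsto_nhdsWithin_of_tendsto_nhds ?_, ?_⟩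
  · have : Continuous fun x : ℝ => 2 * (1 - x) := by fun_prop
    simpa using this.tendsto 1
  · filter_upwards [self_mem_nhdsWithin] with x hx
    simpa using hx

theorem limsup_eq_zero_iff_tendsto {ι : Type*} {l : Filter ι} {b : ι → ℝ≥0∞} :
    limsup b l = 0 ↔ Tendsto b l (𝓝 0) := by
  rcases l.eq_or_neBot with rfl | _
  · simp [limsup_bot]
  · exact ⟨fun h => tendsto_of_le_liminf_of_limsup_le bot_le h.le, Tendsto.limsup_eq⟩

theorem ofReal_weight_mul_scale_le {K : ℝ} (hK : 0 ≤ K) (hc : ∀ n, 0 ≤ c n) {N : ℕ} {z : ℂ}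
    (hz : z ∈ disk) (hpow : 1 / 2 ≤ ‖φ z‖ ^ N) (hΦ : Φ ‖φ z‖ ≤ K * c N) :
    ENNReal.ofReal ((1 - ‖z‖ ^ 2) ^ β * ‖G z‖ * Φ ‖φ z‖) ≤ ENNReal.ofReal (2 * K) *
      (ENNReal.ofReal (c N) * weightedSup β (fun w => G w * φ w ^ N)) := by
  have hw : 0 ≤ (1 - ‖z‖ ^ 2) ^ β := (weight_pos β ⟨z, hz⟩).le
  have hKc : 0 ≤ K * c N := mul_nonneg hK (hc N)
  calc ENNReal.ofReal ((1 - ‖z‖ ^ 2) ^ β * ‖G z‖ * Φ ‖φ z‖)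
      ≤ ENNReal.ofReal ((2 * K) * (c N * ((1 - ‖z‖ ^ 2) ^ β * ‖G z * φ z ^ N‖))) := by
        refine ENNReal.ofReal_le_ofReal ?_
        rw [norm_mul, norm_pow]
        calc (1 - ‖z‖ ^ 2) ^ β * ‖G z‖ * Φ ‖φ z‖
            ≤ (1 - ‖z‖ ^ 2) ^ β * ‖G z‖ * (K * c N * (2 * ‖φ z‖ ^ N)) := by
              gcongr
              nlinarith
          _ = _ := by ring
    _ ≤ _ := by
        rw [ENNReal.ofReal_mul (by positivity), ENNReal.ofReal_mul (hc N)]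
        gcongr
        exact ofReal_le_weightedSup (f := fun w => G w * φ w ^ N) hz

theorem MatchingScale.vanishesTowardBoundary (h : MatchingScale c Φ)
    (hφm : Set.MapsTo φ disk disk)
    (hb : Tendsto (fun n => ENNReal.ofReal (c n) * weightedSup β (fun z => G z * φ z ^ n))
      atTop (𝓝 0)) : VanishesTowardBoundary β φ G Φ := by
  obtain ⟨K, hK0, hK⟩ := h.scale_le
  have hIco : ∀ z : disk, ‖φ z‖ ∈ Set.Ico (0 : ℝ) 1 :=
    fun z => ⟨norm_nonneg _, norm_lt_one (hφm z.2)⟩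
  set N : disk → ℕ := fun z => ⌊(2 * (1 - ‖φ z‖))⁻¹⌋₊
  have hN : Tendsto N (towardBoundary φ) atTop :=
    tendsto_floor_inv_one_sub.comp (tendsto_norm_towardBoundary φ)
  have hle : ∀ᶠ z : disk in towardBoundary φ,
      ENNReal.ofReal ((1 - ‖(z : ℂ)‖ ^ 2) ^ β * ‖G z‖ * Φ ‖φ z‖) ≤ ENNReal.ofReal (2 * K) *
        (ENNReal.ofReal (c (N z)) * weightedSup β (fun w => G w * φ w ^ N z)) := by
    filter_upwards [hN.eventually hK] with z hz
    refine ofReal_weight_mul_scale_le hK0 h.coeff_nonneg z.2 (half_le_pow_floor (hIco z))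
      (hz _ (hIco z) ?_)
    have hx : 0 < 1 - ‖φ z‖ := sub_pos.2 (hIco z).2
    calc (1 - ‖φ z‖)⁻¹ = 2 * (2 * (1 - ‖φ z‖))⁻¹ := by field_simp
      _ ≤ 2 * ((N z : ℝ) + 1) := by gcongr; exact (Nat.lt_floor_add_one _).le
  have hlim : Tendsto (fun z : disk => ENNReal.ofReal (2 * K) *
      (ENNReal.ofReal (c (N z)) * weightedSup β (fun w => G w * φ w ^ N z)))
      (towardBoundary φ) (𝓝 0) := by
    simpa only [mul_zero, Function.comp_def] using
      ENNReal.Tendsto.const_mul (hb.comp hN) (Or.inr ENNReal.ofReal_ne_top)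
  have hofReal := tendsto_of_tendsto_of_tendsto_of_le_of_le' tendsto_const_nhds hlim
    (Eventually.of_forall fun _ => zero_le) hle
  refine ((ENNReal.tendsto_toReal ENNReal.zero_ne_top).comp hofReal).congr fun z => ?_
  exact ENNReal.toReal_ofReal
    (mul_nonneg (mul_nonneg (weight_pos β z).le (norm_nonneg _)) (h.scale_nonneg _ (hIco z)))

theorem VanishesTowardBoundary.tendsto_weightedSup_mul_comp (hv : VanishesTowardBoundary β φ G Φ)
    (hφm : Set.MapsTo φ disk disk) (hG : weightedSup β G < ∞) {ι : Type*} {l : Filter ι}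
    {H : ι → ℂ → ℂ} (hH : TendstoLocallyUniformlyOn H 0 l disk) {K : ℝ}
    (hHΦ : ∀ i, ∀ w ∈ disk, ‖H i w‖ ≤ K * Φ ‖w‖) :
    Tendsto (fun i => weightedSup β fun z => G z * H i (φ z)) l (𝓝 0) := by
  refine tendsto_weightedSup_zero fun ε hε => ?_
  obtain ⟨r, hr1, hr⟩ := ((hasBasis_towardBoundary φ).eventually_iff).1
    ((hv.const_mul K).eventually_le_const (by rwa [mul_zero]))
  set S := (weightedSup β G).toReal
  have hS : 0 ≤ S := ENNReal.toReal_nonneg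
  have hunif : TendstoUniformlyOn H 0 l (Metric.closedBall 0 r) :=
    (tendstoLocallyUniformlyOn_iff_forall_isCompact Metric.isOpen_ball).1 hH _
      (Metric.closedBall_subset_ball hr1) (isCompact_closedBall 0 r)
  filter_upwards [Metric.tendstoUniformlyOn_iff.1 hunif (ε / (S + 1)) (by positivity)]
    with i hi z hz
  have hw := (weight_pos β ⟨z, hz⟩).le
  rw [norm_mul]
  rcases lt_or_ge r ‖φ z‖ with hrz | hrz
  · calc (1 - ‖z‖ ^ 2) ^ β * (‖G z‖ * ‖H i (φ z)‖)
        ≤ (1 - ‖z‖ ^ 2) ^ β * (‖G z‖ * (K * Φ ‖φ z‖)) := by gcongr; exact hHΦ i _ (hφm hz)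
      _ = K * ((1 - ‖z‖ ^ 2) ^ β * ‖G z‖ * Φ ‖φ z‖) := by ring
      _ ≤ ε := hr (x := ⟨z, hz⟩) ⟨hrz, norm_lt_one (hφm hz)⟩
  · have hHz : ‖H i (φ z)‖ ≤ ε / (S + 1) := by simpa using (hi (φ z) (by simpa using hrz)).le
    calc (1 - ‖z‖ ^ 2) ^ β * (‖G z‖ * ‖H i (φ z)‖) ≤ S * (ε / (S + 1)) := by
          rw [← mul_assoc]; gcongr; exact le_toReal_weightedSup hG hz
      _ ≤ ε := mul_div_add_one_le hS hε.le

theorem MatchingScale.tendstoLocallyUniformlyOn_mul_pow (h : MatchingScale c Φ) :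
    TendstoLocallyUniformlyOn (fun n w => (c n : ℂ) * w ^ n) 0 atTop disk := by
  refine tendstoLocallyUniformlyOn_of_forall_exists_nhds fun z hz => ?_
  obtain ⟨r, hzr, hr⟩ := exists_between (norm_lt_one hz)
  have hr0 : 0 ≤ r := (norm_nonneg z).trans hzr.le
  refine ⟨Metric.closedBall 0 r, mem_nhdsWithin_of_mem_nhds
    (Metric.closedBall_mem_nhds_of_mem (mem_ball_zero_iff.2 hzr)),
    Metric.tendstoUniformlyOn_iff.2 fun ε hε => ?_⟩
  filter_upwards [(h.tendsto_mul_pow ⟨hr0, hr⟩).eventually_lt_const hε] with n hn w hw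
  have hc := h.coeff_nonneg n
  calc dist 0 ((c n : ℂ) * w ^ n) = c n * ‖w‖ ^ n := by simp [abs_of_nonneg hc]
    _ ≤ c n * r ^ n := by gcongr; exact mem_closedBall_zero_iff.1 hw
    _ < ε := hn

theorem MatchingScale.tendsto_weightedSup_mul_pow (h : MatchingScale c Φ)
    (hφm : Set.MapsTo φ disk disk) (hG : weightedSup β G < ∞)
    (hv : VanishesTowardBoundary β φ G Φ) :
    Tendsto (fun n => ENNReal.ofReal (c n) * weightedSup β (fun z => G z * φ z ^ n))
      atTop (𝓝 0) := by
  obtain ⟨K, -, hK⟩ := h.coeff_mul_pow_le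
  refine (hv.tendsto_weightedSup_mul_comp hφm hG h.tendstoLocallyUniformlyOn_mul_pow
    (K := K) fun n w hw => ?_).congr fun n => ?_
  · simpa [abs_of_nonneg (h.coeff_nonneg n)] using hK n _ ⟨norm_nonneg w, norm_lt_one hw⟩
  · simp only [mul_left_comm (G _), weightedSup_smul, Complex.norm_of_nonneg (h.coeff_nonneg n)]

theorem MatchingScale.limsup_eq_zero_iff (h : MatchingScale c Φ)
    (hφm : Set.MapsTo φ disk disk) (hG : weightedSup β G < ∞) :
    limsup (fun n => ENNReal.ofReal (c n) * weightedSup β (fun z => G z * φ z ^ n)) atTop = 0 ↔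
      VanishesTowardBoundary β φ G Φ :=
  limsup_eq_zero_iff_tendsto.trans
    ⟨h.vanishesTowardBoundary hφm, h.tendsto_weightedSup_mul_pow hφm hG⟩

end Scales

/-! ### The power and logarithmic scales -/

theorem one_sub_le_one_sub_sq {x : ℝ} (hx : x ∈ Set.Ico (0 : ℝ) 1) : 1 - x ≤ 1 - x ^ 2 := by
  nlinarith [hx.1, hx.2]

theorem one_sub_sq_le_two_mul_one_sub (x : ℝ) : 1 - x ^ 2 ≤ 2 * (1 - x) := by
  nlinarith [sq_nonneg (1 - x)]

theorem rpow_mul_exp_neg_le {γ y : ℝ} (hγ : 0 < γ) (hy : 0 ≤ y) :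
    y ^ γ * Real.exp (-y) ≤ γ ^ γ := by
  have hle : y / γ ≤ Real.exp (y / γ) := by linarith [Real.add_one_le_exp (y / γ)]
  have hpow : (y / γ) ^ γ ≤ Real.exp y := by
    calc (y / γ) ^ γ ≤ Real.exp (y / γ) ^ γ := by gcongr
      _ = Real.exp y := by rw [← Real.exp_mul, div_mul_cancel₀ y hγ.ne']
  rw [Real.div_rpow hy hγ.le, div_le_iff₀ (by positivity)] at hpow
  rw [Real.exp_neg, ← div_eq_mul_inv, div_le_iff₀ (Real.exp_pos y)]
  linarith

theorem pow_le_exp_mul_exp_neg {x : ℝ} (hx : 0 ≤ x) (n : ℕ) :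
    x ^ n ≤ Real.exp 1 * Real.exp (-((n + 1) * (1 - x))) := by
  calc x ^ n ≤ Real.exp (-(1 - x)) ^ n := by
        gcongr
        simpa using Real.one_sub_le_exp_neg (1 - x)
    _ = Real.exp (-(n * (1 - x))) := by rw [← Real.exp_nat_mul]; ring_nf
    _ ≤ Real.exp (1 + -((n + 1) * (1 - x))) := by gcongr; linarith
    _ = _ := Real.exp_add _ _

theorem one_add_mul_one_sub_mul_pow_le {x : ℝ} (hx : x ∈ Set.Ico (0 : ℝ) 1) (n : ℕ) :
    (1 + n * (1 - x)) * x ^ n ≤ 1 := by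
  calc (1 + n * (1 - x)) * x ^ n ≤ (1 + (1 - x)) ^ n * x ^ n := by
        gcongr
        · exact pow_nonneg hx.1 n
        · exact one_add_mul_le_pow (by linarith [hx.2]) n
    _ = ((1 + (1 - x)) * x) ^ n := (mul_pow _ _ _).symm
    _ ≤ 1 := pow_le_one₀ (mul_nonneg (by linarith [hx.2]) hx.1) (by nlinarith [sq_nonneg (1 - x)])

theorem matchingScale_rpow {γ : ℝ} (hγ : 0 < γ) :
    MatchingScale (fun n => ((n : ℝ) + 1) ^ γ) (fun x => (1 - x ^ 2) ^ (-γ)) where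
  coeff_nonneg n := by positivity
  scale_nonneg x hx :=
    Real.rpow_nonneg ((sub_pos.2 hx.2).le.trans (one_sub_le_one_sub_sq hx)) _
  coeff_mul_pow_le := by
    refine ⟨Real.exp 1 * (2 ^ γ * γ ^ γ), by positivity, fun n x hx => ?_⟩
    have hx1 : 0 < 1 - x := sub_pos.2 hx.2
    have hx2 : 0 < 1 - x ^ 2 := hx1.trans_le (one_sub_le_one_sub_sq hx)
    have hy : 0 ≤ ((n : ℝ) + 1) * (1 - x) := by positivity
    rw [Real.rpow_neg hx2.le, ← div_eq_mul_inv, le_div_iff₀ (by positivity)]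
    calc ((n : ℝ) + 1) ^ γ * x ^ n * (1 - x ^ 2) ^ γ
        ≤ ((n : ℝ) + 1) ^ γ * (Real.exp 1 * Real.exp (-((n + 1) * (1 - x)))) *
            (2 * (1 - x)) ^ γ := by
          gcongr
          · exact pow_le_exp_mul_exp_neg hx.1 n
          · exact one_sub_sq_le_two_mul_one_sub x
      _ = Real.exp 1 * (2 ^ γ * ((((n : ℝ) + 1) * (1 - x)) ^ γ *
            Real.exp (-((n + 1) * (1 - x))))) := by
          rw [Real.mul_rpow zero_le_two hx1.le, Real.mul_rpow (by positivity) hx1.le]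
          ring
      _ ≤ Real.exp 1 * (2 ^ γ * γ ^ γ) := by
          gcongr
          exact rpow_mul_exp_neg_le hγ hy
  scale_le := by
    refine ⟨2 ^ γ, by positivity, Eventually.of_forall fun n x hx hn => ?_⟩
    have hx1 : 0 < 1 - x := sub_pos.2 hx.2
    calc (1 - x ^ 2) ^ (-γ) ≤ (1 - x) ^ (-γ) :=
          Real.rpow_le_rpow_of_nonpos hx1 (one_sub_le_one_sub_sq hx) (by linarith)
      _ = (1 - x)⁻¹ ^ γ := by rw [Real.rpow_neg hx1.le, Real.inv_rpow hx1.le]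
      _ ≤ (2 * ((n : ℝ) + 1)) ^ γ := by gcongr
      _ = 2 ^ γ * ((n : ℝ) + 1) ^ γ := Real.mul_rpow zero_le_two (by positivity)

theorem log_mul_pow_le {x : ℝ} (hx : x ∈ Set.Ico (0 : ℝ) 1) (n : ℕ) :
    Real.log n * x ^ n ≤ 2 * (1 - Real.log (1 - x ^ 2)) := by
  have hx2 : 0 < 1 - x ^ 2 := (sub_pos.2 hx.2).trans_le (one_sub_le_one_sub_sq hx)
  have hlog : Real.log (1 - x ^ 2) ≤ 0 := Real.log_nonpos hx2.le (by nlinarith [hx.1])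
  rcases n.eq_zero_or_pos with rfl | hn
  · simp only [CharP.cast_eq_zero, Real.log_zero, zero_mul]
    linarith
  have hn' : (0 : ℝ) < n := by exact_mod_cast hn
  have hpow : 0 ≤ x ^ n := pow_nonneg hx.1 n
  have hpow1 : x ^ n ≤ 1 := pow_le_one₀ hx.1 hx.2.le
  have hsplit : Real.log n ≤ 2 * (1 + n * (1 - x)) - Real.log (1 - x ^ 2) := by
    have h := Real.log_le_sub_one_of_pos (mul_pos hn' hx2)
    rw [Real.log_mul hn'.ne' hx2.ne'] at h
    nlinarith [one_sub_sq_le_two_mul_one_sub x]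
  calc Real.log n * x ^ n ≤ (2 * (1 + n * (1 - x)) - Real.log (1 - x ^ 2)) * x ^ n := by gcongr
    _ = 2 * ((1 + n * (1 - x)) * x ^ n) - Real.log (1 - x ^ 2) * x ^ n := by ring
    _ ≤ 2 * (1 - Real.log (1 - x ^ 2)) := by
        nlinarith [one_add_mul_one_sub_mul_pow_le hx n]

theorem matchingScale_log :
    MatchingScale (fun n => Real.log n) (fun x => 1 - Real.log (1 - x ^ 2)) where
  coeff_nonneg := Real.log_natCast_nonneg
  scale_nonneg x hx := by
    have := Real.log_nonpos (x := 1 - x ^ 2) (by nlinarith [hx.1, hx.2]) (by nlinarith [hx.1])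
    linarith
  coeff_mul_pow_le := ⟨2, by norm_num, fun n _ hx => log_mul_pow_le hx n⟩
  scale_le := by
    refine ⟨3, by norm_num, eventually_atTop.2 ⟨3, fun n hn x hx hxn => ?_⟩⟩
    have hn' : (3 : ℝ) ≤ n := by exact_mod_cast hn
    have hx1 : 0 < 1 - x := sub_pos.2 hx.2
    have one_le_log : 1 ≤ Real.log n := by
      rw [Real.le_log_iff_exp_le (by linarith)]
      linarith [Real.exp_one_lt_three]
    calc 1 - Real.log (1 - x ^ 2) ≤ 1 + Real.log (1 - x)⁻¹ := by
          rw [Real.log_inv, ← sub_eq_add_neg]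
          exact sub_le_sub_left (Real.log_le_log hx1 (one_sub_le_one_sub_sq hx)) 1
      _ ≤ 1 + Real.log ((n : ℝ) ^ 2) := by
          gcongr
          nlinarith
      _ ≤ 3 * Real.log n := by
          rw [Real.log_pow]
          push_cast
          linarith

/-! ### Growth of functions in `𝓑^α` -/

theorem norm_le_toReal_weightedSup_mul {γ : ℝ} {f : ℂ → ℂ} (h : weightedSup γ f < ∞) {z : ℂ}
    (hz : z ∈ disk) : ‖f z‖ ≤ (weightedSup γ f).toReal * (1 - ‖z‖ ^ 2) ^ (-γ) := by
  rw [Real.rpow_neg (one_sub_norm_sq_pos hz).le, ← div_eq_mul_inv,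
    le_div_iff₀ (weight_pos γ ⟨z, hz⟩), mul_comm]
  exact le_toReal_weightedSup h hz

theorem one_sub_norm_sq_rpow_neg_le {γ : ℝ} (hγ : 0 ≤ γ) {z : ℂ} {s : ℝ} (hs : 0 < s)
    (hz : ‖z‖ ≤ 1 - s) : (1 - ‖z‖ ^ 2) ^ (-γ) ≤ s ^ (-γ) := by
  refine Real.rpow_le_rpow_of_nonpos hs ?_ (neg_nonpos.2 hγ)
  linarith [one_sub_le_one_sub_sq ⟨norm_nonneg z, (by linarith : ‖z‖ < 1)⟩]

namespace Bloch

variable {α : ℝ}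

theorem norm_apply_zero_le (f : Bloch α) : ‖f.toFun 0‖ ≤ ‖f‖ := by
  rw [Bloch.norm_def]
  exact le_add_of_nonneg_right ENNReal.toReal_nonneg

theorem norm_apply_zero_add_le (f : Bloch α) {z : ℂ} (hz : z ∈ disk) :
    ‖f.toFun 0‖ + (1 - ‖z‖ ^ 2) ^ α * ‖deriv f.toFun z‖ ≤ ‖f‖ := by
  rw [Bloch.norm_def]
  gcongr
  exact le_toReal_weightedSup f.mem.2 hz

theorem norm_deriv_le (f : Bloch α) {z : ℂ} (hz : z ∈ disk) :
    ‖deriv f.toFun z‖ ≤ ‖f‖ * (1 - ‖z‖ ^ 2) ^ (-α) := by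
  refine (norm_le_toReal_weightedSup_mul f.mem.2 hz).trans (mul_le_mul_of_nonneg_right ?_
    (weight_pos (-α) ⟨z, hz⟩).le)
  rw [Bloch.norm_def]
  exact le_add_of_nonneg_left (norm_nonneg _)

theorem norm_deriv_le_of_le (hα : 0 ≤ α) (f : Bloch α) {z : ℂ} {s : ℝ} (hs : 0 < s)
    (hz : ‖z‖ ≤ 1 - s) : ‖deriv f.toFun z‖ ≤ ‖f‖ * s ^ (-α) :=
  (f.norm_deriv_le (mem_disk (by linarith))).trans
    (mul_le_mul_of_nonneg_left (one_sub_norm_sq_rpow_neg_le hα hs hz) (norm_nonneg f))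

theorem norm_deriv_deriv_le (hα : 0 ≤ α) (f : Bloch α) {z : ℂ} (hz : z ∈ disk) :
    ‖deriv (deriv f.toFun) z‖ ≤ 4 ^ (α + 1) * ‖f‖ * (1 - ‖z‖ ^ 2) ^ (-(α + 1)) := by
  set ρ := (1 - ‖z‖) / 2 with hρ
  have hρ0 : 0 < ρ := by linarith [norm_lt_one hz]
  have hs := one_sub_norm_sq_pos hz
  have hnorm : ∀ w ∈ Metric.closedBall z ρ, ‖w‖ ≤ 1 - ρ := by
    intro w hw
    linarith [norm_le_norm_add_norm_sub' w z, mem_closedBall_iff_norm.1 hw]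
  have hdiff : DiffContOnCl ℂ (deriv f.toFun) (Metric.ball z ρ) := by
    refine ((f.mem.1.1.deriv Metric.isOpen_ball).mono fun w hw => ?_).diffContOnCl
    exact mem_disk (by linarith [hnorm w (Metric.closure_ball_subset_closedBall hw)])
  calc ‖deriv (deriv f.toFun) z‖ ≤ ‖f‖ * ρ ^ (-α) / ρ :=
        Complex.norm_deriv_le_of_forall_mem_sphere_norm_le hρ0 hdiff fun w hw =>
          f.norm_deriv_le_of_le hα hρ0 (hnorm w (Metric.sphere_subset_closedBall hw))
    _ = ‖f‖ * ρ ^ (-(α + 1)) := by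
        rw [mul_div_assoc, neg_add, ← sub_eq_add_neg, Real.rpow_sub_one hρ0.ne']
    _ ≤ ‖f‖ * ((1 - ‖z‖ ^ 2) / 4) ^ (-(α + 1)) := by
        refine mul_le_mul_of_nonneg_left ?_ (norm_nonneg f)
        refine Real.rpow_le_rpow_of_nonpos (by positivity) ?_ (by linarith)
        linarith [one_sub_sq_le_two_mul_one_sub ‖z‖]
    _ = 4 ^ (α + 1) * ‖f‖ * (1 - ‖z‖ ^ 2) ^ (-(α + 1)) := by
        rw [Real.div_rpow hs.le (by norm_num), Real.rpow_neg (by norm_num : (0 : ℝ) ≤ 4)]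
        field_simp

theorem norm_apply_le_add_radial (hα : 0 ≤ α) (f : Bloch α) {B : ℝ → ℝ}
    (hB : ∀ t ∈ Set.Ico (0 : ℝ) 1, HasDerivAt B ((1 - t) ^ (-α)) t) {z : ℂ} (hz : z ∈ disk)
    {s : ℝ} (hs : s ∈ Set.Icc (0 : ℝ) 1) :
    ‖f.toFun z‖ ≤ ‖f.toFun (s * z)‖ + ‖f‖ * (B ‖z‖ - B (s * ‖z‖)) := by
  have hz1 := norm_lt_one hz
  have hlt : ∀ x ∈ Set.Icc s 1, x * ‖z‖ ∈ Set.Ico (0 : ℝ) 1 := fun x hx =>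
    ⟨mul_nonneg (hs.1.trans hx.1) (norm_nonneg z), by nlinarith [hx.2, norm_nonneg z]⟩
  have hnorm : ∀ x ∈ Set.Icc s 1, ‖(x : ℂ) * z‖ = x * ‖z‖ := fun x hx => by
    rw [norm_mul, Complex.norm_of_nonneg (hs.1.trans hx.1)]
  have hd : ∀ x ∈ Set.Icc s 1, HasDerivAt (fun x : ℝ => f.toFun (x * z))
      (deriv f.toFun (x * z) * z) x := by
    intro x hx
    have hxz : (x : ℂ) * z ∈ disk := mem_disk ((hnorm x hx).trans_lt (hlt x hx).2)
    refine (holo_diff f.mem.1 hxz).hasDerivAt.comp x ?_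
    simpa using (Complex.ofRealCLM.hasDerivAt (x := x)).mul_const z
  have hB' : ∀ x ∈ Set.Icc s 1, HasDerivAt
      (fun x => ‖f.toFun (s * z)‖ + ‖f‖ * (B (x * ‖z‖) - B (s * ‖z‖)))
      (‖f‖ * ((1 - x * ‖z‖) ^ (-α) * ‖z‖)) x := by
    intro x hx
    have := (hB _ (hlt x hx)).comp x ((hasDerivAt_id x).mul_const ‖z‖)
    simpa using! ((this.sub_const (B (s * ‖z‖))).const_mul ‖f‖).const_add ‖f.toFun (s * z)‖
  have := image_norm_le_of_norm_deriv_right_le_deriv_boundary' (a := s) (b := 1)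
    (fun x hx => (hd x hx).continuousAt.continuousWithinAt)
    (fun x hx => (hd x (Set.Ico_subset_Icc_self hx)).hasDerivWithinAt) (by simp)
    (fun x hx => (hB' x hx).continuousAt.continuousWithinAt)
    (fun x hx => (hB' x (Set.Ico_subset_Icc_self hx)).hasDerivWithinAt) (fun x hx => ?_)
    (Set.right_mem_Icc.2 hs.2)
  · simpa using this
  · have hx' := Set.Ico_subset_Icc_self hx
    rw [norm_mul, ← mul_assoc]
    gcongr
    exact f.norm_deriv_le_of_le hα (sub_pos.2 (hlt x hx').2) (by rw [hnorm x hx', sub_sub_cancel])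

theorem norm_apply_le_log (f : Bloch 1) {z : ℂ} (hz : z ∈ disk) :
    ‖f.toFun z‖ ≤ 2 * ‖f‖ * (1 - Real.log (1 - ‖z‖ ^ 2)) := by
  have hB : ∀ t ∈ Set.Ico (0 : ℝ) 1,
      HasDerivAt (fun x => -Real.log (1 - x)) ((1 - t) ^ (-(1 : ℝ))) t := fun t ht => by
    convert! (((hasDerivAt_id t).const_sub 1).log (sub_pos.2 ht.2).ne').neg using 1
    rw [Real.rpow_neg_one]
    simp [neg_div]
  have hradial := f.norm_apply_le_add_radial zero_le_one hB hz ⟨le_rfl, zero_le_one⟩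
  simp only [Complex.ofReal_zero, zero_mul, sub_zero, Real.log_one, neg_zero] at hradial
  have hs := one_sub_norm_sq_pos hz
  have hlog : Real.log (1 - ‖z‖ ^ 2) ≤ Real.log 2 + Real.log (1 - ‖z‖) := by
    rw [← Real.log_mul two_ne_zero (sub_pos.2 (norm_lt_one hz)).ne']
    exact Real.log_le_log hs (one_sub_sq_le_two_mul_one_sub _)
  have hlog0 : Real.log (1 - ‖z‖ ^ 2) ≤ 0 := Real.log_nonpos hs.le (by nlinarith [norm_nonneg z])
  calc ‖f.toFun z‖ ≤ ‖f‖ * (1 + -Real.log (1 - ‖z‖)) := by linarith [f.norm_apply_zero_le]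
    _ ≤ ‖f‖ * (2 * (1 - Real.log (1 - ‖z‖ ^ 2))) := by
        gcongr
        linarith [Real.log_two_lt_d9]
    _ = 2 * ‖f‖ * (1 - Real.log (1 - ‖z‖ ^ 2)) := by ring

theorem hasDerivAt_one_sub_rpow_div (hα : α ≠ 1) {t : ℝ} (ht : t ∈ Set.Ico (0 : ℝ) 1) :
    HasDerivAt (fun x => (1 - x) ^ (1 - α) / (α - 1)) ((1 - t) ^ (-α)) t := by
  have hα' : α - 1 ≠ 0 := sub_ne_zero.2 hα
  convert! (((hasDerivAt_id t).const_sub 1).rpow_const (p := 1 - α)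
    (Or.inl (sub_pos.2 ht.2).ne')).div_const (α - 1) using 1
  rw [show 1 - α - 1 = -α by ring]
  field_simp
  simp only [id]
  ring

theorem norm_apply_le_rpow (hα : 1 < α) (f : Bloch α) {z : ℂ} (hz : z ∈ disk) :
    ‖f.toFun z‖ ≤ (1 + 2 ^ (α - 1) / (α - 1)) * ‖f‖ * (1 - ‖z‖ ^ 2) ^ (-(α - 1)) := by
  have : 0 < α - 1 := sub_pos.2 hα
  have hradial := f.norm_apply_le_add_radial (by linarith)
    (fun _ => hasDerivAt_one_sub_rpow_div hα.ne') hz ⟨le_rfl, zero_le_one⟩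
  simp only [Complex.ofReal_zero, zero_mul, sub_zero, Real.one_rpow] at hradial
  have hs := one_sub_norm_sq_pos hz
  have hone : 1 ≤ (1 - ‖z‖ ^ 2) ^ (-(α - 1)) :=
    Real.one_le_rpow_of_pos_of_le_one_of_nonpos hs (by nlinarith [norm_nonneg z]) (by linarith)
  have hhalf : (1 - ‖z‖) ^ (1 - α) ≤ 2 ^ (α - 1) * (1 - ‖z‖ ^ 2) ^ (-(α - 1)) := by
    calc (1 - ‖z‖) ^ (1 - α) ≤ ((1 - ‖z‖ ^ 2) / 2) ^ (1 - α) := by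
          refine Real.rpow_le_rpow_of_nonpos (by positivity) ?_ (by linarith)
          linarith [one_sub_sq_le_two_mul_one_sub ‖z‖]
      _ = 2 ^ (α - 1) * (1 - ‖z‖ ^ 2) ^ (-(α - 1)) := by
          rw [← neg_sub α 1, Real.div_rpow hs.le zero_le_two, Real.rpow_neg zero_le_two (α - 1)]
          field_simp
  calc ‖f.toFun z‖ ≤ ‖f‖ + ‖f‖ * ((1 - ‖z‖) ^ (1 - α) / (α - 1) - 1 / (α - 1)) := by
        linarith [f.norm_apply_zero_le]
    _ ≤ ‖f‖ * (1 - ‖z‖ ^ 2) ^ (-(α - 1)) +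
          ‖f‖ * (2 ^ (α - 1) * (1 - ‖z‖ ^ 2) ^ (-(α - 1)) / (α - 1)) := by
        gcongr
        · exact le_mul_of_one_le_right (norm_nonneg f) hone
        · refine (sub_le_self _ (by positivity)).trans ?_
          gcongr
    _ = _ := by ring

theorem norm_apply_le_add_of_lt_one (hα : 0 ≤ α) (hα1 : α < 1) (f : Bloch α) {z : ℂ}
    (hz : z ∈ disk) {s : ℝ} (hs : s ∈ Set.Icc (0 : ℝ) 1) :
    ‖f.toFun z‖ ≤ ‖f.toFun (s * z)‖ + ‖f‖ * ((1 - s) ^ (1 - α) / (1 - α)) := by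
  have hα' : 0 < 1 - α := sub_pos.2 hα1
  have hz1 : 0 ≤ 1 - ‖z‖ := (sub_pos.2 (norm_lt_one hz)).le
  have hs1 : 0 ≤ 1 - s := sub_nonneg.2 hs.2
  have hsub : (1 - s * ‖z‖) ^ (1 - α) ≤ (1 - ‖z‖) ^ (1 - α) + (1 - s) ^ (1 - α) := by
    calc (1 - s * ‖z‖) ^ (1 - α) ≤ ((1 - ‖z‖) + (1 - s)) ^ (1 - α) :=
          Real.rpow_le_rpow (by nlinarith [hs.1, norm_nonneg z]) (by nlinarith) hα'.le
      _ ≤ (1 - ‖z‖) ^ (1 - α) + (1 - s) ^ (1 - α) :=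
          Real.rpow_add_le_add_rpow hz1 hs1 hα'.le (by linarith)
  refine (f.norm_apply_le_add_radial hα (fun _ => hasDerivAt_one_sub_rpow_div hα1.ne) hz
    hs).trans ?_
  gcongr
  rw [← sub_div, ← neg_sub 1 α, div_neg, ← neg_div]
  gcongr
  linarith

theorem tendstoUniformlyOn_zero_of_lt_one (hα : 0 ≤ α) (hα1 : α < 1) {ι : Type*} {l : Filter ι}
    {F : ι → Bloch α} {C : ℝ} (hC : ∀ᶠ i in l, ‖F i‖ ≤ C)
    (hF : TendstoLocallyUniformlyOn (fun i => (F i).toFun) 0 l disk) :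
    TendstoUniformlyOn (fun i => (F i).toFun) 0 l disk := by
  refine Metric.tendstoUniformlyOn_iff.2 fun ε hε => ?_
  have hα' : 0 < 1 - α := sub_pos.2 hα1
  have hlim : Tendsto (fun s : ℝ => C * ((1 - s) ^ (1 - α) / (1 - α))) (𝓝[<] 1) (𝓝 0) := by
    have : Continuous fun s : ℝ => C * ((1 - s) ^ (1 - α) / (1 - α)) :=
      continuous_const.mul (((continuous_const.sub continuous_id).rpow_const
        fun _ => Or.inr hα'.le).div_const _)
    simpa [hα'.ne'] using (this.tendsto 1).mono_left nhdsWithin_le_nhds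
  obtain ⟨s, hsε, hs0, hs1⟩ := ((hlim.eventually_lt_const (half_pos hε)).and
    (Ioo_mem_nhdsLT (zero_lt_one' ℝ))).exists
  have hball : Metric.closedBall (0 : ℂ) s ⊆ disk := Metric.closedBall_subset_ball hs1
  have hunif := Metric.tendstoUniformlyOn_iff.1
    ((tendstoLocallyUniformlyOn_iff_forall_isCompact Metric.isOpen_ball).1 hF _ hball
      (isCompact_closedBall 0 s)) (ε / 2) (half_pos hε)
  filter_upwards [hC, hunif] with i hi hFi z hz
  have hsz : (s : ℂ) * z ∈ Metric.closedBall (0 : ℂ) s := by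
    rw [mem_closedBall_zero_iff, norm_mul, Complex.norm_of_nonneg hs0.le]
    exact mul_le_of_le_one_right hs0.le (norm_lt_one hz).le
  have hsmall := hFi _ hsz
  simp only [Pi.zero_apply, dist_zero_left] at hsmall ⊢
  calc ‖(F i).toFun z‖
      ≤ ‖(F i).toFun (s * z)‖ + ‖F i‖ * ((1 - s) ^ (1 - α) / (1 - α)) :=
        (F i).norm_apply_le_add_of_lt_one hα hα1 hz ⟨hs0.le, hs1.le⟩
    _ ≤ ‖(F i).toFun (s * z)‖ + C * ((1 - s) ^ (1 - α) / (1 - α)) := by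
        have := Real.rpow_nonneg (sub_pos.2 hs1).le (1 - α)
        gcongr
    _ < ε := by linarith

end Bloch

/-! ### Normal families in `𝓑^α` -/

theorem norm_apply_le_of_norm_deriv_le {f : ℂ → ℂ} (hf : DifferentiableOn ℂ f disk) {r M : ℝ}
    (hr : r < 1) (hM : ∀ w, ‖w‖ ≤ r → ‖deriv f w‖ ≤ M) {z : ℂ} (hz : ‖z‖ ≤ r) :
    ‖f z‖ ≤ ‖f 0‖ + M := by
  have hball : ∀ w ∈ Metric.closedBall (0 : ℂ) r, ‖w‖ ≤ r := fun w hw => by simpa using hw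
  have hmvt := (convex_closedBall (0 : ℂ) r).norm_image_sub_le_of_norm_deriv_le
    (fun w hw => hf.differentiableAt
      (Metric.isOpen_ball.mem_nhds (mem_disk ((hball w hw).trans_lt hr))))
    (fun w hw => hM w (hball w hw)) (x := 0) (y := z)
    (by simpa using (norm_nonneg z).trans hz) (by simpa using hz)
  have hM0 : 0 ≤ M := (norm_nonneg _).trans (hM z hz)
  rw [sub_zero] at hmvt
  have := mul_le_of_le_one_right hM0 (hz.trans hr.le)
  linarith [norm_le_norm_add_norm_sub' (f z) (f 0)]

namespace Bloch

variable {α : ℝ}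

theorem toFun_sub (f g : Bloch α) : (f - g).toFun = f.toFun - g.toFun := rfl

/-- The element of `𝓑^α` given by a function analytic on the disk. Its values outside the disk are
replaced by `0`, as required of the elements of `holo`. -/
def ofFun (f : ℂ → ℂ) (hf : DifferentiableOn ℂ f disk) (h : weightedSup α (deriv f) < ∞) :
    Bloch α :=
  ⟨disk.indicator f, ⟨hf.congr fun _ hz => Set.indicator_of_mem hz f,
    fun _ hz => Set.indicator_of_notMem hz f⟩, by
    refine (weightedSup_congr fun z hz => ?_).trans_lt h
    exact (Set.eqOn_indicator.eventuallyEq_of_mem (Metric.isOpen_ball.mem_nhds hz)).deriv_eq⟩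

section ofFun

variable {f : ℂ → ℂ} {hf : DifferentiableOn ℂ f disk} {h : weightedSup α (deriv f) < ∞}

theorem ofFun_apply {z : ℂ} (hz : z ∈ disk) : (ofFun f hf h).toFun z = f z :=
  Set.indicator_of_mem hz f

theorem deriv_ofFun {z : ℂ} (hz : z ∈ disk) : deriv (ofFun f hf h).toFun z = deriv f z :=
  (Set.eqOn_indicator.eventuallyEq_of_mem (Metric.isOpen_ball.mem_nhds hz)).deriv_eq

theorem deriv_deriv_ofFun {z : ℂ} (hz : z ∈ disk) :
    deriv (deriv (ofFun f hf h).toFun) z = deriv (deriv f) z := by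
  refine Filter.EventuallyEq.deriv_eq ?_
  filter_upwards [Metric.isOpen_ball.mem_nhds hz] with w hw using deriv_ofFun hw

theorem norm_ofFun_le {C : ℝ} (hC : ∀ z ∈ disk, ‖f 0‖ + (1 - ‖z‖ ^ 2) ^ α * ‖deriv f z‖ ≤ C) :
    ‖ofFun f hf h‖ ≤ C := by
  have hsup : weightedSup α (deriv f) ≤ ENNReal.ofReal (C - ‖f 0‖) :=
    weightedSup_le_ofReal fun z hz => by linarith [hC z hz]
  have hpos : 0 ≤ C - ‖f 0‖ := by
    have := mul_nonneg (weight_pos α ⟨0, zero_mem_disk⟩).le (norm_nonneg (deriv f 0))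
    linarith [hC 0 zero_mem_disk]
  rw [Bloch.norm_def, ofFun_apply zero_mem_disk, weightedSup_congr fun z hz => deriv_ofFun hz]
  linarith [ENNReal.toReal_le_of_le_ofReal hpos hsup]

end ofFun

theorem lipschitzOnWith_closedBall (hα : 0 ≤ α) {f : Bloch α} {C : ℝ} (hf : ‖f‖ ≤ C) {r : ℝ}
    (hr : r < 1) :
    LipschitzOnWith (C * (1 - r) ^ (-α)).toNNReal f.toFun (Metric.closedBall 0 r) := by
  have hr' : 0 < 1 - r := sub_pos.2 hr
  refine (convex_closedBall 0 r).lipschitzOnWith_of_nnnorm_deriv_le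
    (fun z hz => holo_diff f.mem.1 (Metric.closedBall_subset_ball hr hz)) fun z hz => ?_
  rw [← NNReal.coe_le_coe, coe_nnnorm]
  refine le_trans ?_ (Real.le_coe_toNNReal _)
  calc ‖deriv f.toFun z‖ ≤ ‖f‖ * (1 - r) ^ (-α) :=
        f.norm_deriv_le_of_le hα hr' (by rw [sub_sub_cancel]; exact mem_closedBall_zero_iff.1 hz)
    _ ≤ C * (1 - r) ^ (-α) := by gcongr

section Montel

variable {ι : Type*} {F : ι → Bloch α} {C : ℝ}

theorem tendstoLocallyUniformlyOn_of_tendsto (hα : 0 ≤ α) (hF : ∀ i, ‖F i‖ ≤ C) {l : Filter ι}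
    {g : ℂ → ℂ} (hg : ∀ z ∈ disk, Tendsto (fun i => (F i).toFun z) l (𝓝 (g z))) :
    TendstoLocallyUniformlyOn (fun i => (F i).toFun) g l disk := by
  refine tendstoLocallyUniformlyOn_of_forall_exists_nhds fun z hz => ?_
  obtain ⟨r, hzr, hr⟩ := exists_between (norm_lt_one hz)
  have hsub : Metric.closedBall (0 : ℂ) r ⊆ disk := Metric.closedBall_subset_ball hr
  refine ⟨Metric.closedBall 0 r, mem_nhdsWithin_of_mem_nhds
    (Metric.closedBall_mem_nhds_of_mem (mem_ball_zero_iff.2 hzr)), ?_⟩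
  have hequi : EquicontinuousOn (fun i => (F i).toFun) (Metric.closedBall 0 r) :=
    (LipschitzOnWith.uniformEquicontinuousOn _ _
      fun i => lipschitzOnWith_closedBall hα (hF i) hr).equicontinuousOn
  refine UniformOnFun.tendsto_iff_tendstoUniformlyOn.1
    ((EquicontinuousOn.tendsto_uniformOnFun_iff_pi' (𝔖 := {Metric.closedBall (0 : ℂ) r})
      (by rintro _ rfl; exact isCompact_closedBall 0 r)
      (by rintro _ rfl; exact hequi) l g).2 ?_) _ rfl
  rw [Set.sUnion_singleton]
  exact tendsto_pi_nhds.2 fun w => hg w (hsub w.2)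

theorem norm_apply_le (hα : 0 ≤ α) (f : Bloch α) {z : ℂ} (hz : z ∈ disk) :
    ‖f.toFun z‖ ≤ ‖f‖ * (1 + (1 - ‖z‖) ^ (-α)) := by
  have := norm_apply_le_of_norm_deriv_le f.mem.1.1 (norm_lt_one hz)
    (fun w hw => f.norm_deriv_le_of_le hα (sub_pos.2 (norm_lt_one hz)) (by rwa [sub_sub_cancel]))
    le_rfl
  linarith [f.norm_apply_zero_le]

theorem norm_apply_zero_add_le_of_tendstoLocallyUniformlyOn (hF : ∀ i, ‖F i‖ ≤ C)
    {l : Filter ι} [l.NeBot] {g : ℂ → ℂ}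
    (hg : TendstoLocallyUniformlyOn (fun i => (F i).toFun) g l disk) {z : ℂ} (hz : z ∈ disk) :
    ‖g 0‖ + (1 - ‖z‖ ^ 2) ^ α * ‖deriv g z‖ ≤ C := by
  have hderiv := hg.deriv (Eventually.of_forall fun i => (F i).mem.1.1) Metric.isOpen_ball
  exact le_of_tendsto
    ((hg.tendsto_at zero_mem_disk).norm.add ((hderiv.tendsto_at hz).norm.const_mul _))
    (Eventually.of_forall fun i => ((F i).norm_apply_zero_add_le hz).trans (hF i))

theorem exists_tendstoLocallyUniformlyOn (hα : 0 ≤ α) (hF : ∀ i, ‖F i‖ ≤ C) (U : Ultrafilter ι) :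
    ∃ g : Bloch α, ‖g‖ ≤ C ∧
      TendstoLocallyUniformlyOn (fun i => (F i).toFun) g.toFun U disk := by
  have hlim : ∀ z ∈ disk, ∃ y, Tendsto (fun i => (F i).toFun z) U (𝓝 y) := fun z hz => by
    have hbound : ∀ i, (F i).toFun z ∈ Metric.closedBall 0 (C * (1 + (1 - ‖z‖) ^ (-α))) := by
      intro i
      have := Real.rpow_nonneg (sub_pos.2 (norm_lt_one hz)).le (-α)
      exact mem_closedBall_zero_iff.2 (((F i).norm_apply_le hα hz).trans
        (by gcongr; exact hF i))
    obtain ⟨y, -, hy⟩ := (isCompact_closedBall (0 : ℂ) _).ultrafilter_le_nhds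
      (U.map fun i => (F i).toFun z) (tendsto_principal.2 (Eventually.of_forall hbound))
    exact ⟨y, hy⟩
  choose! g hg using hlim
  have hloc := tendstoLocallyUniformlyOn_of_tendsto hα hF hg
  have hnorm : ∀ z ∈ disk, ‖g 0‖ + (1 - ‖z‖ ^ 2) ^ α * ‖deriv g z‖ ≤ C := fun z hz =>
    norm_apply_zero_add_le_of_tendstoLocallyUniformlyOn hF hloc hz
  have hdiff : DifferentiableOn ℂ g disk :=
    hloc.differentiableOn (Eventually.of_forall fun i => (F i).mem.1.1) Metric.isOpen_ball
  have hfin : weightedSup α (deriv g) < ∞ :=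
    (weightedSup_le_ofReal fun z hz => (le_add_of_nonneg_left (norm_nonneg _)).trans
      (hnorm z hz)).trans_lt ENNReal.ofReal_lt_top
  exact ⟨ofFun g hdiff hfin, norm_ofFun_le hnorm,
    hloc.congr_right fun z hz => (ofFun_apply hz).symm⟩

end Montel

theorem isCompactOperator_of_tendsto {E : Type*} [NormedAddCommGroup E] [NormedSpace ℂ E]
    (hα : 0 ≤ α) (T : Bloch α →ₗ[ℂ] E)
    (hT : ∀ {ι : Type} (l : Filter ι) (F : ι → Bloch α) (C : ℝ), (∀ i, ‖F i‖ ≤ C) →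
      TendstoLocallyUniformlyOn (fun i => (F i).toFun) 0 l disk →
      Tendsto (fun i => T (F i)) l (𝓝 0)) : IsCompactOperator T := by
  refine ⟨T '' Metric.closedBall 0 1, isCompact_iff_ultrafilter_le_nhds'.2 fun U hU => ?_,
    mem_of_superset (Metric.closedBall_mem_nhds 0 one_pos) (Set.subset_preimage_image _ _)⟩
  let F : Metric.closedBall (0 : Bloch α) 1 → Bloch α := Subtype.val
  have hF : ∀ i, ‖F i‖ ≤ 1 := fun i => mem_closedBall_zero_iff.1 i.2
  have hrange : (fun i => T (F i)) '' Set.univ ∈ U := by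
    rwa [Set.image_univ, Set.range_comp' T F, Subtype.range_coe]
  let V := Ultrafilter.ofComapInfPrincipal hrange
  obtain ⟨g, hg1, hg⟩ := exists_tendstoLocallyUniformlyOn hα hF V
  refine ⟨T g, ⟨g, mem_closedBall_zero_iff.2 hg1, rfl⟩, ?_⟩
  have hsub : Tendsto (fun i => T (F i - g)) V (𝓝 0) := by
    refine hT V (fun i => F i - g) (1 + 1) (fun i => (norm_sub_le _ _).trans
      (add_le_add (hF i) hg1)) ?_
    simpa [Metric.tendstoLocallyUniformlyOn_iff, toFun_sub, dist_eq_norm] using! hg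
  have hlim : Tendsto (fun i => T (F i)) V (𝓝 (T g)) :=
    tendsto_sub_nhds_zero_iff.1 (by simpa only [map_sub] using hsub)
  rwa [Tendsto, ← Ultrafilter.coe_map, Ultrafilter.ofComapInfPrincipal_eq_of_map] at hlim

end Bloch

/-! ### Weighted composition operators -/

namespace Zygmund

variable {β : ℝ}

theorem norm_apply_le (hβ : 0 ≤ β) (f : Zygmund β) {z : ℂ} (hz : z ∈ disk) :
    ‖f.toFun z‖ ≤ (1 + (1 - ‖z‖) ^ (-β)) * ‖f‖ := by
  have hz' : 0 < 1 - ‖z‖ := sub_pos.2 (norm_lt_one hz)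
  set S := (weightedSup β (deriv (deriv f.toFun))).toReal with hS
  have hpow := Real.rpow_nonneg hz'.le (-β)
  have hderiv : ∀ w, ‖w‖ ≤ ‖z‖ → ‖deriv f.toFun w‖ ≤ ‖deriv f.toFun 0‖ + S * (1 - ‖z‖) ^ (-β) := by
    refine fun w hw => norm_apply_le_of_norm_deriv_le (f.mem.1.1.deriv Metric.isOpen_ball)
      (norm_lt_one hz) (fun v hv => ?_) hw
    exact (norm_le_toReal_weightedSup_mul f.mem.2 (mem_disk (hv.trans_lt (norm_lt_one hz)))).trans
      (mul_le_mul_of_nonneg_left (one_sub_norm_sq_rpow_neg_le hβ hz' (by rwa [sub_sub_cancel]))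
        ENNReal.toReal_nonneg)
  have hf := norm_apply_le_of_norm_deriv_le f.mem.1.1 (norm_lt_one hz) hderiv le_rfl
  have hS0 : 0 ≤ S := ENNReal.toReal_nonneg
  rw [Zygmund.norm_def, ← hS]
  nlinarith [mul_nonneg hpow (norm_nonneg (f.toFun 0)),
    mul_nonneg hpow (norm_nonneg (deriv f.toFun 0))]

theorem continuous_apply (hβ : 0 ≤ β) {z : ℂ} (hz : z ∈ disk) :
    Continuous fun f : Zygmund β => f.toFun z :=
  AddMonoidHomClass.continuous_of_bound
    (AddMonoidHom.mk' (fun f : Zygmund β => f.toFun z) fun _ _ => rfl) _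
    fun f => norm_apply_le hβ f hz

theorem ext_disk {f g : Zygmund β} (h : Set.EqOn f.toFun g.toFun disk) : f = g := by
  refine Subtype.ext (funext fun z => ?_)
  by_cases hz : z ∈ disk
  · exact h hz
  · exact (f.mem.1.2 z hz).trans (g.mem.1.2 z hz).symm

end Zygmund

/-- The coefficient `2u'φ' + uφ''` of `f' ∘ φ` in `(u · f ∘ φ)''`. -/
def derivCoeff (u φ : ℂ → ℂ) (z : ℂ) : ℂ :=
  2 * deriv u z * deriv φ z + u z * deriv (deriv φ) z

/-- The coefficient `u(φ')²` of `f'' ∘ φ` in `(u · f ∘ φ)''`. -/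
def derivDerivCoeff (u φ : ℂ → ℂ) (z : ℂ) : ℂ :=
  u z * deriv φ z ^ 2

section MulComp

variable {u φ f : ℂ → ℂ} (hu : DifferentiableOn ℂ u disk) (hφ : DifferentiableOn ℂ φ disk)
  (hφm : Set.MapsTo φ disk disk) (hf : DifferentiableOn ℂ f disk)
include hu hφ hφm hf

theorem deriv_mul_comp {z : ℂ} (hz : z ∈ disk) :
    deriv (fun w => u w * f (φ w)) z = deriv u z * f (φ z) + u z * (deriv f (φ z) * deriv φ z) := by
  have hd : ∀ {g : ℂ → ℂ}, DifferentiableOn ℂ g disk → ∀ w ∈ disk, HasDerivAt g (deriv g w) w :=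
    fun hg w hw => (hg.differentiableAt (Metric.isOpen_ball.mem_nhds hw)).hasDerivAt
  exact ((hd hu z hz).mul ((hd hf _ (hφm hz)).comp z (hd hφ z hz))).deriv

theorem deriv_deriv_mul_comp {z : ℂ} (hz : z ∈ disk) :
    deriv (deriv fun w => u w * f (φ w)) z = deriv (deriv u) z * f (φ z)
      + derivCoeff u φ z * deriv f (φ z) + derivDerivCoeff u φ z * deriv (deriv f) (φ z) := by
  have hdiff : ∀ {g : ℂ → ℂ}, DifferentiableOn ℂ g disk → DifferentiableAt ℂ g z :=
    fun hg => hg.differentiableAt (Metric.isOpen_ball.mem_nhds hz)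
  have hf' := hf.deriv Metric.isOpen_ball
  have hφ' := hφ.deriv Metric.isOpen_ball
  have hu' := hu.deriv Metric.isOpen_ball
  have hEq : Set.EqOn (deriv fun w => u w * f (φ w))
      ((fun w => deriv u w * f (φ w)) + fun w => (u * deriv φ) w * deriv f (φ w)) disk :=
    fun w hw => (deriv_mul_comp hu hφ hφm hf hw).trans
      (by simp only [Pi.add_apply, Pi.mul_apply]; ring)
  rw [(hEq.eventuallyEq_of_mem (Metric.isOpen_ball.mem_nhds hz)).deriv_eq,
    deriv_add (hdiff (hu'.fun_mul (hf.fun_comp hφ hφm)))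
      (hdiff ((hu.mul hφ').fun_mul (hf'.fun_comp hφ hφm))),
    deriv_mul_comp hu' hφ hφm hf hz, deriv_mul_comp (hu.mul hφ') hφ hφm hf' hz,
    deriv_mul (hdiff hu) (hdiff hφ'), Pi.mul_apply, derivCoeff, derivDerivCoeff]
  ring

end MulComp

namespace IsWeightedComp

variable {α β : ℝ} {u φ : ℂ → ℂ} {T : Bloch α →ₗ[ℂ] Zygmund β}

theorem tendsto_of_isCompactOperator (hT : IsWeightedComp u φ T) (hβ : 0 ≤ β)
    (hφm : Set.MapsTo φ disk disk) (hc : IsCompactOperator T) {ι : Type*} {l : Filter ι}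
    {F : ι → Bloch α} {C : ℝ} (hF : ∀ i, ‖F i‖ ≤ C)
    (hF0 : ∀ z ∈ disk, Tendsto (fun i => (F i).toFun z) l (𝓝 0)) :
    Tendsto (fun i => T (F i)) l (𝓝 0) := by
  obtain ⟨K, hK, hTK⟩ := hc.image_closedBall_subset_compact (f := T) C
  refine hK.tendsto_nhds_of_unique_mapClusterPt
    (Eventually.of_forall fun i => hTK ⟨F i, mem_closedBall_zero_iff.2 (hF i), rfl⟩)
    fun g _ hg => Zygmund.ext_disk fun z hz => ?_
  have hlim : Tendsto (fun i => (T (F i)).toFun z) l (𝓝 0) := by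
    simpa only [hT _ z hz, mul_zero] using (hF0 _ (hφm hz)).const_mul (u z)
  have hcluster : MapClusterPt (g.toFun z) l fun i => (T (F i)).toFun z :=
    hg.continuousAt_comp (Zygmund.continuous_apply hβ hz).continuousAt
  exact eq_of_nhds_neBot (ClusterPt.mono hcluster hlim)

variable (hT : IsWeightedComp u φ T) (hu : DifferentiableOn ℂ u disk)
  (hφ : DifferentiableOn ℂ φ disk) (hφm : Set.MapsTo φ disk disk)
include hT hu hφ hφm

theorem deriv_apply (f : Bloch α) {z : ℂ} (hz : z ∈ disk) : deriv (T f).toFun z =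
    deriv u z * f.toFun (φ z) + u z * (deriv f.toFun (φ z) * deriv φ z) := by
  have hEq : Set.EqOn (T f).toFun (fun w => u w * f.toFun (φ w)) disk := hT f
  rw [hEq.deriv Metric.isOpen_ball hz, deriv_mul_comp hu hφ hφm f.mem.1.1 hz]

theorem deriv_deriv_apply (f : Bloch α) {z : ℂ} (hz : z ∈ disk) : deriv (deriv (T f).toFun) z =
    deriv (deriv u) z * f.toFun (φ z) + derivCoeff u φ z * deriv f.toFun (φ z)
      + derivDerivCoeff u φ z * deriv (deriv f.toFun) (φ z) := by
  have hEq : Set.EqOn (T f).toFun (fun w => u w * f.toFun (φ w)) disk := hT f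
  rw [(hEq.deriv Metric.isOpen_ball).deriv Metric.isOpen_ball hz,
    deriv_deriv_mul_comp hu hφ hφm f.mem.1.1 hz]

end IsWeightedComp

/-! ### Sufficiency -/

theorem weightedSup_sub_mul_lt_top {γ : ℝ} {f g ψ : ℂ → ℂ} (hf : weightedSup γ f < ∞)
    (hg : weightedSup γ g < ∞) (hψ : ∀ z ∈ disk, ‖ψ z‖ ≤ 1) :
    weightedSup γ (fun z => f z - g z * ψ z) < ∞ := by
  have hmul : weightedSup γ (fun z => -(g z * ψ z)) ≤ weightedSup γ g :=
    weightedSup_mono fun z hz => by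
      rw [norm_neg, norm_mul]
      exact mul_le_of_le_one_right (norm_nonneg _) (hψ z hz)
  simp only [sub_eq_add_neg]
  exact (weightedSup_add_le γ f _).trans_lt (ENNReal.add_lt_top.2 ⟨hf, hmul.trans_lt hg⟩)

/-- The monomial `zⁿ` as an element of `𝓑^α`. -/
def Bloch.monomial {α : ℝ} (hα : 0 ≤ α) (n : ℕ) : Bloch α :=
  ofFun (fun z => z ^ n) (by fun_prop) <| by
    refine (weightedSup_le_ofReal (C := n) fun z hz => ?_).trans_lt ENNReal.ofReal_lt_top
    have hs := one_sub_norm_sq_pos hz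
    have hweight : (1 - ‖z‖ ^ 2) ^ α ≤ 1 :=
      Real.rpow_le_one hs.le (by nlinarith [norm_nonneg z]) hα
    have hderiv : ‖deriv (fun w : ℂ => w ^ n) z‖ ≤ n := by
      simpa using mul_le_of_le_one_right n.cast_nonneg
        (pow_le_one₀ (norm_nonneg z) (norm_lt_one hz).le)
    exact (mul_le_of_le_one_left (norm_nonneg _) hweight).trans hderiv

theorem Zygmund.tendsto_zero {β : ℝ} {ι : Type*} {l : Filter ι} {F : ι → Zygmund β}
    (h : Tendsto (fun i => (F i).toFun 0) l (𝓝 0))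
    (h' : Tendsto (fun i => deriv (F i).toFun 0) l (𝓝 0))
    (h'' : Tendsto (fun i => weightedSup β (deriv (deriv (F i).toFun))) l (𝓝 0)) :
    Tendsto F l (𝓝 0) := by
  refine tendsto_zero_iff_norm_tendsto_zero.2 ?_
  simpa only [Zygmund.norm_def, norm_zero, ENNReal.toReal_zero, add_zero] using!
    (h.norm.add h'.norm).add ((ENNReal.tendsto_toReal ENNReal.zero_ne_top).comp h'')

/-- The boundary conditions on the three coefficients of `(u · f ∘ φ)''` that characterize
compactness: each coefficient is weighted by the growth of the corresponding derivative
of a function in `𝓑^α`. -/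
structure VanishingCoefficients (α β : ℝ) (u φ : ℂ → ℂ) : Prop where
  derivCoeff : VanishesTowardBoundary β φ (derivCoeff u φ) fun x => (1 - x ^ 2) ^ (-α)
  derivDerivCoeff :
    VanishesTowardBoundary β φ (derivDerivCoeff u φ) fun x => (1 - x ^ 2) ^ (-(α + 1))
  deriv_deriv_log : α = 1 →
    VanishesTowardBoundary β φ (deriv (deriv u)) fun x => 1 - Real.log (1 - x ^ 2)
  deriv_deriv_rpow : 1 < α →
    VanishesTowardBoundary β φ (deriv (deriv u)) fun x => (1 - x ^ 2) ^ (-(α - 1))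

theorem vanishingCoefficients_iff {α β : ℝ} {u φ : ℂ → ℂ} : VanishingCoefficients α β u φ ↔
    (VanishesTowardBoundary β φ (derivCoeff u φ) fun x => (1 - x ^ 2) ^ (-α)) ∧
    (VanishesTowardBoundary β φ (derivDerivCoeff u φ) fun x => (1 - x ^ 2) ^ (-(α + 1))) ∧
    (α = 1 →
      VanishesTowardBoundary β φ (deriv (deriv u)) fun x => 1 - Real.log (1 - x ^ 2)) ∧
    (1 < α →
      VanishesTowardBoundary β φ (deriv (deriv u)) fun x => (1 - x ^ 2) ^ (-(α - 1))) :=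
  ⟨fun ⟨hA, hB, hlog, hrpow⟩ => ⟨hA, hB, hlog, hrpow⟩,
    fun ⟨hA, hB, hlog, hrpow⟩ => ⟨hA, hB, hlog, hrpow⟩⟩

namespace IsWeightedComp

variable {α β : ℝ} {u φ : ℂ → ℂ} {T : Bloch α →ₗ[ℂ] Zygmund β} (hT : IsWeightedComp u φ T)
  (hα : 0 ≤ α) (hu : DifferentiableOn ℂ u disk) (hφ : DifferentiableOn ℂ φ disk)
  (hφm : Set.MapsTo φ disk disk)
include hT hα hu hφ hφm

theorem deriv_deriv_apply_monomial (n : ℕ) {z : ℂ} (hz : z ∈ disk) :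
    deriv (deriv (T (Bloch.monomial hα n)).toFun) z =
      deriv (deriv u) z * φ z ^ n + derivCoeff u φ z * (n * φ z ^ (n - 1))
        + derivDerivCoeff u φ z * (n * (↑(n - 1) * φ z ^ (n - 1 - 1))) := by
  rw [hT.deriv_deriv_apply hu hφ hφm _ hz, Bloch.monomial, Bloch.ofFun_apply (hφm hz),
    Bloch.deriv_ofFun (hφm hz), Bloch.deriv_deriv_ofFun (hφm hz),
    show deriv (fun w : ℂ => w ^ n) = fun w : ℂ => (n : ℂ) * w ^ (n - 1) by ext w; simp]
  simp

theorem weightedSup_deriv_deriv_lt_top : weightedSup β (deriv (deriv u)) < ∞ := by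
  refine (weightedSup_congr fun z hz => ?_).trans_lt (T (Bloch.monomial hα 0)).mem.2
  simp [hT.deriv_deriv_apply_monomial hα hu hφ hφm 0 hz]

theorem weightedSup_derivCoeff_lt_top : weightedSup β (derivCoeff u φ) < ∞ := by
  refine (weightedSup_congr fun z hz => ?_).trans_lt (weightedSup_sub_mul_lt_top
    (T (Bloch.monomial hα 1)).mem.2 (hT.weightedSup_deriv_deriv_lt_top hα hu hφ hφm)
    fun z hz => (norm_lt_one (hφm hz)).le)
  simp [hT.deriv_deriv_apply_monomial hα hu hφ hφm 1 hz]

theorem weightedSup_derivDerivCoeff_lt_top : weightedSup β (derivDerivCoeff u φ) < ∞ := by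
  have hφ1 : ∀ z ∈ disk, ‖φ z‖ ≤ 1 := fun z hz => (norm_lt_one (hφm hz)).le
  have hA := hT.weightedSup_derivCoeff_lt_top hα hu hφ hφm
  have hdouble := weightedSup_sub_mul_lt_top (weightedSup_sub_mul_lt_top
    (weightedSup_sub_mul_lt_top (T (Bloch.monomial hα 2)).mem.2
      (hT.weightedSup_deriv_deriv_lt_top hα hu hφ hφm)
      (ψ := fun z => φ z ^ 2) fun z hz => by
        rw [norm_pow]; exact pow_le_one₀ (norm_nonneg _) (hφ1 z hz)) hA hφ1) hA hφ1
  refine lt_of_le_of_lt (weightedSup_mono fun z hz => ?_) hdouble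
  rw [hT.deriv_deriv_apply_monomial hα hu hφ hφm 2 hz]
  calc ‖derivDerivCoeff u φ z‖ ≤ ‖2 * derivDerivCoeff u φ z‖ := by
        rw [norm_mul, Complex.norm_two]
        exact le_mul_of_one_le_left (norm_nonneg _) one_le_two
    _ = _ := by congr 1; push_cast; ring

section Sufficiency

variable {ι : Type*} {l : Filter ι} {F : ι → Bloch α} {C : ℝ}

theorem tendsto_weightedSup_deriv_deriv_mul_comp (hv : VanishingCoefficients α β u φ)
    (hC : ∀ i, ‖F i‖ ≤ C)
    (hF : TendstoLocallyUniformlyOn (fun i => (F i).toFun) 0 l disk) :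
    Tendsto (fun i => weightedSup β fun z => deriv (deriv u) z * (F i).toFun (φ z)) l (𝓝 0) := by
  have hfin := hT.weightedSup_deriv_deriv_lt_top hα hu hφ hφm
  rcases lt_trichotomy α 1 with hα1 | rfl | hα1
  · exact tendsto_weightedSup_mul_of_tendstoUniformlyOn hfin
      (((Bloch.tendstoUniformlyOn_zero_of_lt_one hα hα1 (Eventually.of_forall hC) hF).comp φ).mono
        hφm)
  · refine (hv.deriv_deriv_log rfl).tendsto_weightedSup_mul_comp hφm hfin hF (K := 2 * C)
      fun i w hw => ((F i).norm_apply_le_log hw).trans ?_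
    have hlog := Real.log_nonpos (one_sub_norm_sq_pos hw).le (by nlinarith [norm_nonneg w])
    gcongr
    · linarith
    · exact hC i
  · refine (hv.deriv_deriv_rpow hα1).tendsto_weightedSup_mul_comp hφm hfin hF
      (K := (1 + 2 ^ (α - 1) / (α - 1)) * C)
      fun i w hw => ((F i).norm_apply_le_rpow hα1 hw).trans ?_
    have hpos := (weight_pos (-(α - 1)) ⟨w, hw⟩).le
    have : 0 < α - 1 := sub_pos.2 hα1
    gcongr
    exact hC i

theorem tendsto_weightedSup_deriv_deriv_apply (hv : VanishingCoefficients α β u φ)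
    (hC : ∀ i, ‖F i‖ ≤ C)
    (hF : TendstoLocallyUniformlyOn (fun i => (F i).toFun) 0 l disk) :
    Tendsto (fun i => weightedSup β (deriv (deriv (T (F i)).toFun))) l (𝓝 0) := by
  have hF' : TendstoLocallyUniformlyOn (fun i => deriv (F i).toFun) 0 l disk := by
    simpa using! hF.deriv (Eventually.of_forall fun i => (F i).mem.1.1) Metric.isOpen_ball
  have hF'' : TendstoLocallyUniformlyOn (fun i => deriv (deriv (F i).toFun)) 0 l disk := by
    simpa using! hF'.deriv (Eventually.of_forall fun i => (F i).mem.1.1.deriv Metric.isOpen_ball)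
      Metric.isOpen_ball
  have hpos : ∀ γ : ℝ, ∀ w ∈ disk, 0 ≤ (1 - ‖w‖ ^ 2) ^ γ := fun γ w hw => (weight_pos γ ⟨w, hw⟩).le
  have h₀ := hT.tendsto_weightedSup_deriv_deriv_mul_comp hα hu hφ hφm hv hC hF
  have h₁ := hv.derivCoeff.tendsto_weightedSup_mul_comp hφm
    (hT.weightedSup_derivCoeff_lt_top hα hu hφ hφm) hF' (K := C) fun i w hw =>
      ((F i).norm_deriv_le hw).trans (mul_le_mul_of_nonneg_right (hC i) (hpos _ w hw))
  have h₂ := hv.derivDerivCoeff.tendsto_weightedSup_mul_comp hφm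
    (hT.weightedSup_derivDerivCoeff_lt_top hα hu hφ hφm) hF'' (K := 4 ^ (α + 1) * C) fun i w hw =>
      ((F i).norm_deriv_deriv_le hα hw).trans (mul_le_mul_of_nonneg_right
        (mul_le_mul_of_nonneg_left (hC i) (by positivity)) (hpos _ w hw))
  refine tendsto_of_tendsto_of_tendsto_of_le_of_le tendsto_const_nhds
    (by simpa using (h₀.add h₁).add h₂) (fun _ => zero_le) fun i => ?_
  calc weightedSup β (deriv (deriv (T (F i)).toFun))
      = weightedSup β _ := weightedSup_congr fun z hz => hT.deriv_deriv_apply hu hφ hφm (F i) hz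
    _ ≤ _ := (weightedSup_add_le β _ _).trans (add_le_add_left (weightedSup_add_le β _ _) _)

theorem isCompactOperator (hv : VanishingCoefficients α β u φ) : IsCompactOperator T := by
  refine Bloch.isCompactOperator_of_tendsto hα T fun l F C hC hF => ?_
  have hφ0 := hφm zero_mem_disk
  have hderiv : Tendsto (fun i => deriv (F i).toFun (φ 0)) l (𝓝 0) := by
    simpa using! (hF.deriv (Eventually.of_forall fun i => (F i).mem.1.1)
      Metric.isOpen_ball).tendsto_at hφ0
  refine Zygmund.tendsto_zero ?_ ?_
    (hT.tendsto_weightedSup_deriv_deriv_apply hα hu hφ hφm hv hC hF)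
  · simpa [hT _ 0 zero_mem_disk] using! (hF.tendsto_at hφ0).const_mul (u 0)
  · simpa [hT.deriv_apply hu hφ hφm _ zero_mem_disk] using!
      ((hF.tendsto_at hφ0).const_mul (deriv u 0)).add
        ((hderiv.mul_const (deriv φ 0)).const_mul (u 0))

end Sufficiency

end IsWeightedComp

/-! ### Test kernels -/

theorem one_sub_norm_le_norm_one_sub_conj_mul {a : ℂ} (ha : a ∈ disk) (z : ℂ) :
    1 - ‖z‖ ≤ ‖1 - conj a * z‖ := by
  have hmul : ‖conj a * z‖ ≤ ‖z‖ := by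
    rw [norm_mul, Complex.norm_conj]
    exact mul_le_of_le_one_left (norm_nonneg z) (norm_lt_one ha).le
  have := norm_sub_norm_le 1 (conj a * z)
  rw [norm_one] at this
  linarith

theorem half_le_norm_one_sub_conj_mul_right {a z : ℂ} (ha : a ∈ disk) :
    (1 - ‖z‖ ^ 2) / 2 ≤ ‖1 - conj a * z‖ := by
  linarith [one_sub_norm_le_norm_one_sub_conj_mul ha z, one_sub_sq_le_two_mul_one_sub ‖z‖]

theorem half_le_norm_one_sub_conj_mul_left {a z : ℂ} (hz : z ∈ disk) :
    (1 - ‖a‖ ^ 2) / 2 ≤ ‖1 - conj a * z‖ := by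
  have hconj : ‖1 - conj a * z‖ = ‖1 - conj z * a‖ := by
    rw [← Complex.norm_conj]
    simp [mul_comm]
  exact hconj ▸ half_le_norm_one_sub_conj_mul_right hz

theorem norm_conj_mul_lt_one {a z : ℂ} (ha : a ∈ disk) (hz : z ∈ disk) : ‖conj a * z‖ < 1 := by
  rw [norm_mul, Complex.norm_conj]
  exact mul_lt_one_of_nonneg_of_lt_one_left (norm_nonneg a) (norm_lt_one ha) (norm_lt_one hz).le

theorem norm_one_sub_conj_mul_le_two {a z : ℂ} (ha : a ∈ disk) (hz : z ∈ disk) :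
    ‖1 - conj a * z‖ ≤ 2 := by
  have := norm_sub_le 1 (conj a * z)
  rw [norm_one] at this
  linarith [norm_conj_mul_lt_one ha hz]

theorem one_sub_conj_mul_mem_slitPlane {a z : ℂ} (ha : a ∈ disk) (hz : z ∈ disk) :
    1 - conj a * z ∈ Complex.slitPlane := by
  rw [sub_eq_add_neg]
  exact Complex.mem_slitPlane_of_norm_lt_one (by rw [norm_neg]; exact norm_conj_mul_lt_one ha hz)

theorem one_sub_conj_mul_self (a : ℂ) : 1 - conj a * a = ((1 - ‖a‖ ^ 2 : ℝ) : ℂ) := by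
  rw [Complex.conj_mul']
  push_cast
  rfl

theorem hasDerivAt_one_sub_conj_mul (a z : ℂ) :
    HasDerivAt (fun w => 1 - conj a * w) (-conj a) z := by
  simpa using ((hasDerivAt_id z).const_mul (conj a)).const_sub 1

/-- The power kernel `(1 - |a|²)^(p + 1 - γ) (1 - āz)^(-p)`. The normalization is such that its
value at `z = a` is `(1 - |a|²)^(1 - γ)` for every `p`, and that differentiation shifts `(γ, p)`
to `(γ + 1, p + 1)`. -/
def powKernel (γ p : ℝ) (a z : ℂ) : ℂ :=
  ((1 - ‖a‖ ^ 2) ^ (p + 1 - γ) : ℝ) * (1 - conj a * z) ^ ((-p : ℝ) : ℂ)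

section PowKernel

variable {γ p : ℝ} {a z : ℂ} (ha : a ∈ disk)
include ha

theorem powKernel_self : powKernel γ p a a = ((1 - ‖a‖ ^ 2) ^ (-(γ - 1)) : ℝ) := by
  have hs := one_sub_norm_sq_pos ha
  rw [powKernel, one_sub_conj_mul_self, ← Complex.ofReal_cpow hs.le, ← Complex.ofReal_mul,
    ← Real.rpow_add hs]
  ring_nf

theorem hasDerivAt_powKernel (hz : z ∈ disk) :
    HasDerivAt (powKernel γ p a) (p * conj a * powKernel (γ + 1) (p + 1) a z) z := by
  convert! (((hasDerivAt_one_sub_conj_mul a z).cpow_const (c := ((-p : ℝ) : ℂ))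
    (one_sub_conj_mul_mem_slitPlane ha hz)).const_mul
      (((1 - ‖a‖ ^ 2) ^ (p + 1 - γ) : ℝ) : ℂ)) using 1
  rw [powKernel, show p + 1 + 1 - (γ + 1) = p + 1 - γ by ring,
    show ((-(p + 1) : ℝ) : ℂ) = ((-p : ℝ) : ℂ) - 1 by push_cast; ring]
  push_cast
  ring

theorem deriv_powKernel (hz : z ∈ disk) :
    deriv (powKernel γ p a) z = p * conj a * powKernel (γ + 1) (p + 1) a z :=
  (hasDerivAt_powKernel ha hz).deriv

theorem deriv_deriv_powKernel (hz : z ∈ disk) :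
    deriv (deriv (powKernel γ p a)) z =
      p * (p + 1) * conj a ^ 2 * powKernel (γ + 1 + 1) (p + 1 + 1) a z := by
  have hEq : Set.EqOn (deriv (powKernel γ p a))
      (fun w => p * conj a * powKernel (γ + 1) (p + 1) a w) disk :=
    fun w hw => deriv_powKernel ha hw
  rw [hEq.deriv Metric.isOpen_ball hz, ((hasDerivAt_powKernel ha hz).const_mul _).deriv]
  push_cast
  ring

theorem norm_powKernel_le (hp : 0 ≤ p) (hz : z ∈ disk) : ‖powKernel γ p a z‖ ≤
    (1 - ‖a‖ ^ 2) ^ (p + 1 - γ) * ((1 - ‖z‖ ^ 2) / 2) ^ (-p) := by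
  have hweight := (weight_pos (p + 1 - γ) ⟨a, ha⟩).le
  rw [powKernel, norm_mul, Complex.norm_of_nonneg hweight, Complex.norm_cpow_real]
  exact mul_le_mul_of_nonneg_left (Real.rpow_le_rpow_of_nonpos
    (half_pos (one_sub_norm_sq_pos hz)) (half_le_norm_one_sub_conj_mul_right ha)
    (by linarith)) hweight

theorem norm_powKernel_le_rpow (hγ : 1 ≤ γ) (hp : γ - 1 ≤ p) (hz : z ∈ disk) :
    ‖powKernel γ p a z‖ ≤ 2 ^ p * (1 - ‖z‖ ^ 2) ^ (-(γ - 1)) := by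
  have hs := one_sub_norm_sq_pos ha
  have ht := one_sub_norm_sq_pos hz
  have hk : 0 < ‖1 - conj a * z‖ :=
    (half_pos ht).trans_le (half_le_norm_one_sub_conj_mul_right ha)
  have hweight := (weight_pos (p + 1 - γ) ⟨a, ha⟩).le
  rw [powKernel, norm_mul, Complex.norm_of_nonneg hweight, Complex.norm_cpow_real]
  calc (1 - ‖a‖ ^ 2) ^ (p + 1 - γ) * ‖1 - conj a * z‖ ^ (-p)
      = (1 - ‖a‖ ^ 2) ^ (p + 1 - γ) *
          (‖1 - conj a * z‖ ^ (-(p + 1 - γ)) * ‖1 - conj a * z‖ ^ (-(γ - 1))) := by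
        rw [← Real.rpow_add hk]
        ring_nf
    _ ≤ (1 - ‖a‖ ^ 2) ^ (p + 1 - γ) *
          (((1 - ‖a‖ ^ 2) / 2) ^ (-(p + 1 - γ)) * ((1 - ‖z‖ ^ 2) / 2) ^ (-(γ - 1))) := by
        gcongr ?_ * (?_ * ?_)
        · exact Real.rpow_le_rpow_of_nonpos (half_pos hs) (half_le_norm_one_sub_conj_mul_left hz)
            (by linarith)
        · exact Real.rpow_le_rpow_of_nonpos (half_pos ht) (half_le_norm_one_sub_conj_mul_right ha)
            (by linarith)
    _ = 2 ^ p * (1 - ‖z‖ ^ 2) ^ (-(γ - 1)) := by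
        rw [Real.div_rpow hs.le zero_le_two, Real.div_rpow ht.le zero_le_two, Real.rpow_neg hs.le,
          Real.rpow_neg zero_le_two (p + 1 - γ), Real.rpow_neg zero_le_two (γ - 1),
          show (2 : ℝ) ^ p = 2 ^ (p + 1 - γ) * 2 ^ (γ - 1) by
            rw [← Real.rpow_add two_pos]; ring_nf]
        have := (Real.rpow_pos_of_pos hs (p + 1 - γ)).ne'
        field_simp

theorem weight_mul_norm_deriv_powKernel_le (hγ : 0 ≤ γ) (hp : γ ≤ p) (hz : z ∈ disk) :
    (1 - ‖z‖ ^ 2) ^ γ * ‖deriv (powKernel γ p a) z‖ ≤ p * 2 ^ (p + 1) := by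
  have hp0 := hγ.trans hp
  have hweight := weight_pos γ ⟨z, hz⟩
  have hkernel := norm_powKernel_le_rpow ha (γ := γ + 1) (p := p + 1) (by linarith) (by linarith) hz
  rw [add_sub_cancel_right] at hkernel
  rw [deriv_powKernel ha hz, norm_mul, norm_mul, Complex.norm_of_nonneg hp0, Complex.norm_conj]
  calc (1 - ‖z‖ ^ 2) ^ γ * (p * ‖a‖ * ‖powKernel (γ + 1) (p + 1) a z‖)
      ≤ (1 - ‖z‖ ^ 2) ^ γ * (p * 1 * (2 ^ (p + 1) * (1 - ‖z‖ ^ 2) ^ (-γ))) := by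
        gcongr
        exact (norm_lt_one ha).le
    _ = p * 2 ^ (p + 1) := by
        rw [Real.rpow_neg (one_sub_norm_sq_pos hz).le]
        field_simp

end PowKernel

theorem differentiableOn_powKernel {γ p : ℝ} {a : ℂ} (ha : a ∈ disk) :
    DifferentiableOn ℂ (powKernel γ p a) disk :=
  fun _ hz => (hasDerivAt_powKernel ha hz).differentiableAt.differentiableWithinAt

/-- The power kernel with parameter `a` as an element of `𝓑^α`; its norm is bounded
independently of `a`. -/
def Bloch.powKernel {α p : ℝ} (hα : 0 ≤ α) (hp : α ≤ p) {a : ℂ} (ha : a ∈ disk) : Bloch α :=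
  ofFun (BlochZygmund.powKernel α p a) (differentiableOn_powKernel ha) <|
    (weightedSup_le_ofReal fun _ hz => weight_mul_norm_deriv_powKernel_le ha hα hp hz).trans_lt
      ENNReal.ofReal_lt_top

theorem Bloch.norm_powKernel_le {α p : ℝ} (hα : 0 ≤ α) (hp : α ≤ p) {a : ℂ} (ha : a ∈ disk) :
    ‖Bloch.powKernel hα hp ha‖ ≤ 1 + p * 2 ^ (p + 1) := by
  refine norm_ofFun_le fun z hz => add_le_add ?_ (weight_mul_norm_deriv_powKernel_le ha hα hp hz)
  have hs := one_sub_norm_sq_pos ha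
  have hle : (1 - ‖a‖ ^ 2) ^ (p + 1 - α) ≤ 1 :=
    Real.rpow_le_one hs.le (by nlinarith [norm_nonneg a]) (by linarith)
  simpa [BlochZygmund.powKernel, abs_of_nonneg (Real.rpow_nonneg hs.le _)] using hle

theorem tendsto_powKernel {γ p : ℝ} (hp : 0 ≤ p) (hγ : γ < p + 1) {φ : ℂ → ℂ}
    (hφm : Set.MapsTo φ disk disk) {w : ℂ} (hw : w ∈ disk) :
    Tendsto (fun z : disk => powKernel γ p (φ z) w) (towardBoundary φ) (𝓝 0) := by
  have hlim : Tendsto (fun x : ℝ => (1 - x ^ 2) ^ (p + 1 - γ) * ((1 - ‖w‖ ^ 2) / 2) ^ (-p))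
      (𝓝[<] 1) (𝓝 0) := by
    have : Continuous fun x : ℝ => (1 - x ^ 2) ^ (p + 1 - γ) * ((1 - ‖w‖ ^ 2) / 2) ^ (-p) :=
      (((continuous_const.sub (continuous_id.pow 2)).rpow_const
        fun _ => Or.inr (by linarith)).mul continuous_const)
    simpa [(sub_pos.2 hγ).ne'] using (this.tendsto 1).mono_left nhdsWithin_le_nhds
  exact squeeze_zero_norm (fun z => norm_powKernel_le (hφm z.2) hp hw)
    (hlim.comp (tendsto_norm_towardBoundary φ))

/-- The logarithmic kernel `(1 - log (1 - āz))² / (1 - log (1 - |a|²))`, the test function for the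
borderline case `α = 1`: its value at `z = a` is `1 - log (1 - |a|²)`. -/
def logKernel (a z : ℂ) : ℂ :=
  (1 - Complex.log (1 - conj a * z)) ^ 2 / ((1 - Real.log (1 - ‖a‖ ^ 2) : ℝ) : ℂ)

theorem norm_one_sub_log_le {t : ℝ} (ht : 0 < t) (ht1 : t ≤ 1) {w : ℂ} (htw : t / 2 ≤ ‖w‖)
    (hw : ‖w‖ ≤ 2) : ‖1 - Complex.log w‖ ≤ 5 * (1 - Real.log t) := by
  have hlogt : Real.log t ≤ 0 := Real.log_nonpos ht.le ht1
  have hw0 : 0 < ‖w‖ := (half_pos ht).trans_le htw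
  have hupper : Real.log ‖w‖ ≤ Real.log 2 := Real.log_le_log hw0 hw
  have hlower : Real.log t - Real.log 2 ≤ Real.log ‖w‖ := by
    rw [← Real.log_div ht.ne' two_ne_zero]
    exact Real.log_le_log (half_pos ht) htw
  have hre : |(1 - Complex.log w).re| ≤ 1 + Real.log 2 - Real.log t := by
    rw [Complex.sub_re, Complex.one_re, Complex.log_re, abs_le]
    constructor <;> linarith
  have him : |(1 - Complex.log w).im| ≤ Real.pi := by
    simpa [Complex.log_im] using Complex.abs_arg_le_pi w
  linarith [Complex.norm_le_abs_re_add_abs_im (1 - Complex.log w), Real.log_two_lt_d9,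
    Real.pi_lt_d2]

theorem one_le_one_sub_log {a : ℂ} (ha : a ∈ disk) : 1 ≤ 1 - Real.log (1 - ‖a‖ ^ 2) := by
  linarith [Real.log_nonpos (one_sub_norm_sq_pos ha).le (by nlinarith [norm_nonneg a])]

theorem tendsto_inv_one_sub_log :
    Tendsto (fun x : ℝ => (1 - Real.log (1 - x ^ 2))⁻¹) (𝓝[<] 1) (𝓝 0) := by
  have hsub : Tendsto (fun x : ℝ => 1 - x ^ 2) (𝓝[<] 1) (𝓝[>] 0) := by
    refine tendsto_nhdsWithin_iff.2 ⟨?_, ?_⟩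
    · have : Continuous fun x : ℝ => 1 - x ^ 2 := by fun_prop
      simpa using (this.tendsto 1).mono_left nhdsWithin_le_nhds
    · filter_upwards [Ioo_mem_nhdsLT (zero_lt_one' ℝ)] with x hx
      have := hx.1
      have := hx.2
      change (0 : ℝ) < 1 - x ^ 2
      nlinarith
  refine tendsto_inv_atTop_zero.comp ?_
  simpa only [sub_eq_add_neg, Function.comp_def] using tendsto_atTop_add_const_left _ 1
    (tendsto_neg_atBot_atTop.comp (Real.tendsto_log_nhdsGT_zero.comp hsub))

section LogKernel

variable {a z : ℂ} (ha : a ∈ disk)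
include ha

theorem log_one_sub_conj_mul_self :
    Complex.log (1 - conj a * a) = (Real.log (1 - ‖a‖ ^ 2) : ℝ) := by
  rw [one_sub_conj_mul_self, Complex.ofReal_log (one_sub_norm_sq_pos ha).le]

theorem logKernel_self : logKernel a a = ((1 - Real.log (1 - ‖a‖ ^ 2) : ℝ) : ℂ) := by
  have hL : ((1 - Real.log (1 - ‖a‖ ^ 2) : ℝ) : ℂ) ≠ 0 :=
    Complex.ofReal_ne_zero.2 (zero_lt_one.trans_le (one_le_one_sub_log ha)).ne'
  rw [logKernel, log_one_sub_conj_mul_self ha, div_eq_iff hL]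
  push_cast
  ring

variable (hz : z ∈ disk)
include hz

theorem hasDerivAt_one_sub_log : HasDerivAt (fun w => 1 - Complex.log (1 - conj a * w))
    (conj a * (1 - conj a * z)⁻¹) z := by
  convert! ((hasDerivAt_one_sub_conj_mul a z).clog
    (one_sub_conj_mul_mem_slitPlane ha hz)).const_sub 1 using 1
  rw [neg_div, neg_neg, div_eq_mul_inv]

theorem hasDerivAt_logKernel : HasDerivAt (logKernel a)
    (2 * conj a * (1 - Complex.log (1 - conj a * z)) * (1 - conj a * z)⁻¹ /
      ((1 - Real.log (1 - ‖a‖ ^ 2) : ℝ) : ℂ)) z := by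
  convert! ((hasDerivAt_one_sub_log ha hz).pow 2).div_const _ using 1
  push_cast
  ring

theorem deriv_deriv_logKernel : deriv (deriv (logKernel a)) z =
    2 * conj a ^ 2 * (2 - Complex.log (1 - conj a * z)) * (1 - conj a * z)⁻¹ ^ 2 /
      ((1 - Real.log (1 - ‖a‖ ^ 2) : ℝ) : ℂ) := by
  have hEq : Set.EqOn (deriv (logKernel a)) (fun w => 2 * conj a *
      (1 - Complex.log (1 - conj a * w)) * (1 - conj a * w)⁻¹ /
        ((1 - Real.log (1 - ‖a‖ ^ 2) : ℝ) : ℂ)) disk :=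
    fun w hw => (hasDerivAt_logKernel ha hw).deriv
  have hinv : HasDerivAt (fun w => (1 - conj a * w)⁻¹) (conj a * (1 - conj a * z)⁻¹ ^ 2) z := by
    simpa [div_eq_mul_inv] using (hasDerivAt_one_sub_conj_mul a z).fun_inv
      (Complex.slitPlane_ne_zero (one_sub_conj_mul_mem_slitPlane ha hz))
  rw [hEq.deriv Metric.isOpen_ball hz,
    ((((hasDerivAt_one_sub_log ha hz).const_mul (2 * conj a)).fun_mul hinv).div_const _).deriv]
  ring

theorem norm_logKernel_le : ‖logKernel a z‖ ≤
    (5 * (1 - Real.log (1 - ‖z‖ ^ 2))) ^ 2 * (1 - Real.log (1 - ‖a‖ ^ 2))⁻¹ := by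
  have hL := one_le_one_sub_log ha
  rw [logKernel, norm_div, norm_pow, Complex.norm_of_nonneg (by linarith), div_eq_mul_inv]
  gcongr
  exact norm_one_sub_log_le (one_sub_norm_sq_pos hz) (by nlinarith [norm_nonneg z])
    (half_le_norm_one_sub_conj_mul_right ha) (norm_one_sub_conj_mul_le_two ha hz)

theorem weight_mul_norm_deriv_logKernel_le :
    (1 - ‖z‖ ^ 2) ^ (1 : ℝ) * ‖deriv (logKernel a) z‖ ≤ 20 := by
  have hL := one_le_one_sub_log ha
  have hL0 : 0 < 1 - Real.log (1 - ‖a‖ ^ 2) := by linarith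
  have ht := one_sub_norm_sq_pos hz
  have hhalf := half_le_norm_one_sub_conj_mul_right ha (z := z)
  have hk : 0 < ‖1 - conj a * z‖ := (half_pos ht).trans_le hhalf
  have hlog := norm_one_sub_log_le (one_sub_norm_sq_pos ha) (by nlinarith [norm_nonneg a])
    (half_le_norm_one_sub_conj_mul_left hz) (norm_one_sub_conj_mul_le_two ha hz)
  rw [(hasDerivAt_logKernel ha hz).deriv, Real.rpow_one, norm_div,
    Complex.norm_of_nonneg hL0.le]
  simp only [norm_mul, Complex.norm_conj, norm_inv, Complex.norm_two]
  calc (1 - ‖z‖ ^ 2) * (2 * ‖a‖ * ‖1 - Complex.log (1 - conj a * z)‖ * ‖1 - conj a * z‖⁻¹ /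
        (1 - Real.log (1 - ‖a‖ ^ 2)))
      ≤ (2 * ‖1 - conj a * z‖) * (2 * 1 * (5 * (1 - Real.log (1 - ‖a‖ ^ 2))) *
          ‖1 - conj a * z‖⁻¹ / (1 - Real.log (1 - ‖a‖ ^ 2))) := by
        gcongr
        · linarith
        · exact (norm_lt_one ha).le
    _ = 20 := by field_simp; norm_num

end LogKernel

theorem differentiableOn_logKernel {a : ℂ} (ha : a ∈ disk) :
    DifferentiableOn ℂ (logKernel a) disk :=
  fun _ hz => (hasDerivAt_logKernel ha hz).differentiableAt.differentiableWithinAt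

/-- The logarithmic kernel with parameter `a` as an element of `𝓑¹`; its norm is bounded
independently of `a`. -/
def Bloch.logKernel {a : ℂ} (ha : a ∈ disk) : Bloch 1 :=
  ofFun (BlochZygmund.logKernel a) (differentiableOn_logKernel ha) <|
    (weightedSup_le_ofReal fun _ hz => weight_mul_norm_deriv_logKernel_le ha hz).trans_lt
      ENNReal.ofReal_lt_top

theorem Bloch.logKernel_apply {a z : ℂ} (ha : a ∈ disk) (hz : z ∈ disk) :
    (Bloch.logKernel ha).toFun z = BlochZygmund.logKernel a z :=
  ofFun_apply hz

theorem Bloch.deriv_logKernel {a z : ℂ} (ha : a ∈ disk) (hz : z ∈ disk) :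
    deriv (Bloch.logKernel ha).toFun z =
      2 * conj a * (1 - Complex.log (1 - conj a * z)) * (1 - conj a * z)⁻¹ /
        ((1 - Real.log (1 - ‖a‖ ^ 2) : ℝ) : ℂ) :=
  (deriv_ofFun hz).trans (hasDerivAt_logKernel ha hz).deriv

theorem Bloch.deriv_deriv_logKernel {a z : ℂ} (ha : a ∈ disk) (hz : z ∈ disk) :
    deriv (deriv (Bloch.logKernel ha).toFun) z =
      2 * conj a ^ 2 * (2 - Complex.log (1 - conj a * z)) * (1 - conj a * z)⁻¹ ^ 2 /
        ((1 - Real.log (1 - ‖a‖ ^ 2) : ℝ) : ℂ) :=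
  (deriv_deriv_ofFun hz).trans (BlochZygmund.deriv_deriv_logKernel ha hz)

theorem Bloch.norm_logKernel_le {a : ℂ} (ha : a ∈ disk) : ‖Bloch.logKernel ha‖ ≤ 25 + 20 := by
  refine norm_ofFun_le fun z hz => add_le_add ?_ (weight_mul_norm_deriv_logKernel_le ha hz)
  calc ‖BlochZygmund.logKernel a 0‖ ≤ 25 * (1 - Real.log (1 - ‖a‖ ^ 2))⁻¹ := by
        simpa [show (5 : ℝ) ^ 2 = 25 by norm_num] using
          BlochZygmund.norm_logKernel_le ha zero_mem_disk
    _ ≤ 25 := mul_le_of_le_one_right (by norm_num) (inv_le_one_of_one_le₀ (one_le_one_sub_log ha))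

theorem tendsto_logKernel {φ : ℂ → ℂ} (hφm : Set.MapsTo φ disk disk) {w : ℂ} (hw : w ∈ disk) :
    Tendsto (fun z : disk => logKernel (φ z) w) (towardBoundary φ) (𝓝 0) :=
  squeeze_zero_norm (fun z => norm_logKernel_le (hφm z.2) hw) <| by
    simpa only [mul_zero] using!
      (tendsto_inv_one_sub_log.comp (tendsto_norm_towardBoundary φ)).const_mul
        ((5 * (1 - Real.log (1 - ‖w‖ ^ 2))) ^ 2)

/-! ### Necessity -/

theorem tendsto_zero_of_forall_tendsto_add_mul {ι : Type*} {l : Filter ι} {X Y Z : ι → ℂ} {p : ℝ}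
    (h : ∀ q ≥ p, Tendsto (fun i => X i + q * Y i + q * (q + 1) * Z i) l (𝓝 0)) :
    Tendsto X l (𝓝 0) ∧ Tendsto Y l (𝓝 0) ∧ Tendsto Z l (𝓝 0) := by
  -- A quadratic polynomial in `q` is recovered from its finite differences at `p`.
  have h₀ := h p le_rfl
  have h₁ := h (p + 1) (by linarith)
  have h₂ := h (p + 2) (by linarith)
  have hZ : Tendsto Z l (𝓝 0) := by
    have := (((h₂.sub (h₁.const_mul 2)).add h₀).const_mul (2⁻¹ : ℂ)).congr (f₂ := Z) fun i => by
      push_cast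
      ring
    simpa using this
  have hY : Tendsto Y l (𝓝 0) := by
    have := ((h₁.sub h₀).sub (hZ.const_mul (2 * ((p : ℂ) + 1)))).congr (f₂ := Y) fun i => by
      push_cast
      ring
    simpa using this
  have hX : Tendsto X l (𝓝 0) := by
    have := ((h₀.sub (hY.const_mul (p : ℂ))).sub (hZ.const_mul ((p : ℂ) * (p + 1)))).congr (f₂ := X)
      fun i => by
        ring
    simpa using this
  exact ⟨hX, hY, hZ⟩

theorem VanishesTowardBoundary.of_tendsto_mul_conj_pow {β : ℝ} {φ G : ℂ → ℂ} {Φ : ℝ → ℝ} (n : ℕ)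
    (h : Tendsto (fun z : disk => (((1 - ‖(z : ℂ)‖ ^ 2) ^ β : ℝ) : ℂ) *
      (G z * (conj (φ z) ^ n * (Φ ‖φ z‖ : ℂ)))) (towardBoundary φ) (𝓝 0)) :
    VanishesTowardBoundary β φ G Φ := by
  have hnorm : Tendsto (fun z : disk => ‖φ z‖) (towardBoundary φ) (𝓝 1) :=
    (tendsto_norm_towardBoundary φ).mono_right nhdsWithin_le_nhds
  refine tendsto_zero_iff_norm_tendsto_zero.2 ?_
  have hdiv := h.norm.div (hnorm.pow n) (by simp)
  rw [norm_zero, zero_div] at hdiv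
  refine hdiv.congr' ?_
  filter_upwards [hnorm.eventually_ne one_ne_zero] with z hz
  have : ‖φ z‖ ≠ 0 := hz
  simp only [Pi.div_apply, norm_mul, norm_pow, Complex.norm_conj, Complex.norm_real, norm_norm]
  field_simp

namespace IsWeightedComp

section Necessity

variable {α β : ℝ} {u φ : ℂ → ℂ} {T : Bloch α →ₗ[ℂ] Zygmund β} (hT : IsWeightedComp u φ T)
  (hβ : 0 ≤ β) (hu : DifferentiableOn ℂ u disk) (hφ : DifferentiableOn ℂ φ disk)
  (hφm : Set.MapsTo φ disk disk) (hc : IsCompactOperator T)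
include hT hβ hu hφ hφm hc

theorem tendsto_weight_mul_of_isCompactOperator {F : disk → Bloch α} {C : ℝ} (hC : ∀ z, ‖F z‖ ≤ C)
    (hF : ∀ w ∈ disk, Tendsto (fun z => (F z).toFun w) (towardBoundary φ) (𝓝 0)) :
    Tendsto (fun z : disk => (((1 - ‖(z : ℂ)‖ ^ 2) ^ β : ℝ) : ℂ) *
      (deriv (deriv u) z * (F z).toFun (φ z) + derivCoeff u φ z * deriv (F z).toFun (φ z)
        + derivDerivCoeff u φ z * deriv (deriv (F z).toFun) (φ z))) (towardBoundary φ) (𝓝 0) := by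
  refine squeeze_zero_norm (fun z => ?_) (tendsto_zero_iff_norm_tendsto_zero.1
    (hT.tendsto_of_isCompactOperator hβ hφm hc hC hF))
  rw [norm_mul, Complex.norm_of_nonneg (weight_pos β z).le,
    ← hT.deriv_deriv_apply hu hφ hφm (F z) z.2, Zygmund.norm_def]
  exact (le_toReal_weightedSup (T (F z)).mem.2 z.2).trans
    (le_add_of_nonneg_left (by positivity))

-- The exponent of `conj (φ z)` is the number of derivatives that fall on the power kernel.
theorem tendsto_coeff_of_isCompactOperator (hα : 0 ≤ α) :
    Tendsto (fun z : disk => (((1 - ‖(z : ℂ)‖ ^ 2) ^ β : ℝ) : ℂ) *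
      (deriv (deriv u) z * (conj (φ z) ^ 0 * (((1 - ‖φ z‖ ^ 2) ^ (-(α - 1)) : ℝ) : ℂ))))
      (towardBoundary φ) (𝓝 0) ∧
    Tendsto (fun z : disk => (((1 - ‖(z : ℂ)‖ ^ 2) ^ β : ℝ) : ℂ) *
      (derivCoeff u φ z * (conj (φ z) ^ 1 * (((1 - ‖φ z‖ ^ 2) ^ (-α) : ℝ) : ℂ))))
      (towardBoundary φ) (𝓝 0) ∧
    Tendsto (fun z : disk => (((1 - ‖(z : ℂ)‖ ^ 2) ^ β : ℝ) : ℂ) *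
      (derivDerivCoeff u φ z * (conj (φ z) ^ 2 * (((1 - ‖φ z‖ ^ 2) ^ (-(α + 1)) : ℝ) : ℂ))))
      (towardBoundary φ) (𝓝 0) := by
  refine tendsto_zero_of_forall_tendsto_add_mul (p := α) fun q hq => ?_
  refine (hT.tendsto_weight_mul_of_isCompactOperator hβ hu hφ hφm hc
    (F := fun z => Bloch.powKernel hα hq (hφm z.2)) (fun z => Bloch.norm_powKernel_le hα hq _)
    fun w hw => ?_).congr fun z => ?_
  · simpa only [Bloch.powKernel, Bloch.ofFun_apply hw] using
      tendsto_powKernel (hα.trans hq) (by linarith) hφm hw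
  · have hφz := hφm z.2
    rw [Bloch.powKernel, Bloch.ofFun_apply hφz, Bloch.deriv_ofFun hφz, Bloch.deriv_deriv_ofFun hφz,
      deriv_deriv_powKernel hφz hφz, deriv_powKernel hφz hφz, powKernel_self hφz,
      powKernel_self hφz, powKernel_self hφz, add_sub_cancel_right, add_sub_cancel_right]
    ring

end Necessity

theorem vanishesTowardBoundary_log_of_isCompactOperator {β : ℝ} {u φ : ℂ → ℂ}
    {T : Bloch 1 →ₗ[ℂ] Zygmund β} (hT : IsWeightedComp u φ T)
    (hβ : 0 ≤ β) (hu : DifferentiableOn ℂ u disk) (hφ : DifferentiableOn ℂ φ disk)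
    (hφm : Set.MapsTo φ disk disk) (hc : IsCompactOperator T) :
    VanishesTowardBoundary β φ (deriv (deriv u)) fun x => 1 - Real.log (1 - x ^ 2) := by
  obtain ⟨-, hA, hB⟩ := hT.tendsto_coeff_of_isCompactOperator hβ hu hφ hφm hc zero_le_one
  have hinv : Tendsto (fun z : disk => (((1 - Real.log (1 - ‖φ z‖ ^ 2))⁻¹ : ℝ) : ℂ))
      (towardBoundary φ) (𝓝 0) := by
    exact_mod_cast (Complex.continuous_ofReal.tendsto 0).comp
      (tendsto_inv_one_sub_log.comp (tendsto_norm_towardBoundary φ))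
  have hkernel := hT.tendsto_weight_mul_of_isCompactOperator hβ hu hφ hφm hc
    (F := fun z => Bloch.logKernel (hφm z.2)) (fun z => Bloch.norm_logKernel_le _)
    fun w hw => by
      simpa only [Bloch.logKernel_apply _ hw] using tendsto_logKernel hφm hw
  refine .of_tendsto_mul_conj_pow 0 ?_
  -- The last two terms of `(u · f ∘ φ)''` at the logarithmic kernel are already known to vanish,
  -- which isolates the term with `u''`.
  have hlim := (hkernel.sub (hA.const_mul 2)).sub (hB.mul ((hinv.const_add 1).const_mul 2))
  simp only [mul_zero, zero_mul, sub_zero] at hlim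
  refine hlim.congr fun z => ?_
  have hφz := hφm z.2
  have hs : ((1 - ‖φ z‖ ^ 2 : ℝ) : ℂ) ≠ 0 :=
    Complex.ofReal_ne_zero.2 (one_sub_norm_sq_pos hφz).ne'
  have hL : 1 - (Real.log (1 - ‖φ z‖ ^ 2) : ℂ) ≠ 0 := by
    exact_mod_cast (zero_lt_one.trans_le (one_le_one_sub_log hφz)).ne'
  rw [Bloch.logKernel_apply hφz hφz, Bloch.deriv_logKernel hφz hφz,
    Bloch.deriv_deriv_logKernel hφz hφz, logKernel_self hφz, log_one_sub_conj_mul_self hφz,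
    one_sub_conj_mul_self,
    show (-((1 : ℝ) + 1)) = ((-2 : ℤ) : ℝ) by norm_num, Real.rpow_intCast, Real.rpow_neg_one]
  push_cast at hs ⊢
  field_simp
  ring

theorem vanishingCoefficients {α β : ℝ} {u φ : ℂ → ℂ} {T : Bloch α →ₗ[ℂ] Zygmund β}
    (hT : IsWeightedComp u φ T) (hα : 0 ≤ α) (hβ : 0 ≤ β) (hu : DifferentiableOn ℂ u disk)
    (hφ : DifferentiableOn ℂ φ disk) (hφm : Set.MapsTo φ disk disk) (hc : IsCompactOperator T) :
    VanishingCoefficients α β u φ := by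
  obtain ⟨hU, hA, hB⟩ := hT.tendsto_coeff_of_isCompactOperator hβ hu hφ hφm hc hα
  exact ⟨.of_tendsto_mul_conj_pow 1 hA, .of_tendsto_mul_conj_pow 2 hB,
    by rintro rfl; exact hT.vanishesTowardBoundary_log_of_isCompactOperator hβ hu hφ hφm hc,
    fun _ => .of_tendsto_mul_conj_pow 0 hU⟩

end IsWeightedComp

theorem CompactWeightedComp.boundedWeightedComp {α β : ℝ} {u φ : ℂ → ℂ}
    (h : CompactWeightedComp α β u φ) : BoundedWeightedComp α β u φ := by
  obtain ⟨T, hT, hc⟩ := h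
  let S : Bloch α →L[ℂ] Zygmund β := ⟨T, hc.continuous⟩
  exact ⟨T, hT, ‖S‖, S.le_opNorm⟩

theorem compactWeightedComp_iff {α β : ℝ} (hα : 0 ≤ α) (hβ : 0 ≤ β) {u φ : ℂ → ℂ}
    (hu : DifferentiableOn ℂ u disk) (hφ : DifferentiableOn ℂ φ disk)
    (hφm : Set.MapsTo φ disk disk) : CompactWeightedComp α β u φ ↔
      BoundedWeightedComp α β u φ ∧ VanishingCoefficients α β u φ := by
  constructor
  · intro h
    obtain ⟨T, hT, hc⟩ := id h
    exact ⟨h.boundedWeightedComp, hT.vanishingCoefficients hα hβ hu hφ hφm hc⟩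
  · rintro ⟨⟨T, hT, -⟩, hv⟩
    exact ⟨T, hT, hT.isCompactOperator hα hu hφ hφm hv⟩

end BlochZygmund

end

theorem mainTheorem7 (α β : ℝ) (hα : 0 < α) (hβ : 0 < β) (u φ : ℂ → ℂ)
    (hu : DifferentiableOn ℂ u BlochZygmund.disk)
    (hφ : DifferentiableOn ℂ φ BlochZygmund.disk)
    (hφ_maps : Set.MapsTo φ BlochZygmund.disk BlochZygmund.disk) :
    BlochZygmund.CompactWeightedComp α β u φ ↔
      BlochZygmund.BoundedWeightedComp α β u φ ∧
      limsup (fun n : ℕ => ENNReal.ofReal (((n : ℝ) + 1) ^ α) *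
        BlochZygmund.weightedSup β (fun z =>
          (2 * deriv u z * deriv φ z + u z * deriv (deriv φ) z) * φ z ^ n)) atTop = 0 ∧
      limsup (fun n : ℕ => ENNReal.ofReal (((n : ℝ) + 1) ^ (α + 1)) *
        BlochZygmund.weightedSup β (fun z => u z * deriv φ z ^ 2 * φ z ^ n)) atTop = 0 ∧
      (α = 1 →
        limsup (fun n : ℕ => ENNReal.ofReal (Real.log n) *
          BlochZygmund.weightedSup β (fun z => deriv (deriv u) z * φ z ^ n)) atTop = 0) ∧
      (1 < α →
        limsup (fun n : ℕ => ENNReal.ofReal (((n : ℝ) + 1) ^ (α - 1)) *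
          BlochZygmund.weightedSup β (fun z => deriv (deriv u) z * φ z ^ n)) atTop = 0) := by
  open BlochZygmund in
  rw [compactWeightedComp_iff hα.le hβ.le hu hφ hφ_maps]
  refine and_congr_right fun ⟨T, hT, _⟩ => ?_
  have hU := hT.weightedSup_deriv_deriv_lt_top hα.le hu hφ hφ_maps
  have hA := hT.weightedSup_derivCoeff_lt_top hα.le hu hφ hφ_maps
  have hB := hT.weightedSup_derivDerivCoeff_lt_top hα.le hu hφ hφ_maps
  rw [vanishingCoefficients_iff]
  exact and_congr ((matchingScale_rpow hα).limsup_eq_zero_iff hφ_maps hA).symm <|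
    and_congr ((matchingScale_rpow (by linarith)).limsup_eq_zero_iff hφ_maps hB).symm <|
    and_congr (forall_congr' fun _ => (matchingScale_log.limsup_eq_zero_iff hφ_maps hU).symm) <|
    forall_congr' fun hα1 =>
      ((matchingScale_rpow (sub_pos.2 hα1)).limsup_eq_zero_iff hφ_maps hU).symm
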